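/- Let $k$ be a field, let $H$ be a finite group acting by automorphisms on a group $\Gamma$, and let $k^H$ be the Hopf algebra of $k$-valued functions on $H$, with indicator functions $\delta_h$. The smash coproduct $k[\Gamma]\rtimes k^H$ is the Hopf algebra equal to $k[\Gamma]\otimes k^H$ as an algebra (write $r\#f=r\otimes f$), with $$\Delta(r\#\delta_h)=\sum_{l\in H} r\#\delta_{l^{-1}}\otimes l\cdot r\#\delta_{lh},\qquad \varepsilon(r\#\delta_h)=\delta_{h,1}.$$ A pair $(N,\Phi)$ is called a quotient datum (with first component $H$) if $N$ is a normal $H$-stable subgroup of $\Gamma$ and $\Phi:N\to (k^H)^\times$ is a group morphism such that $\Phi(r)(lh)=\Phi(l^{-1}\cdot r)(h)\,\Phi(r)(l)$ and $\Phi(r)=\Phi(srs^{-1})$ for all $r\in N$, $s\in\Gamma$, $h,l\in H$. Given a section $j:\Gamma/N\to\Gamma$ of the canonical projection with $j(1)=1$, the Hopf algebra $k[\Gamma/N]\rtimes_\Phi k^H$ is the vector space $k[\Gamma/N]\otimes k^H$ with unit $1\#1$, counit $\varepsilon(x\#\delta_h)=\delta_{h,1}$ and $$(x\#\delta_h)(y\#\delta_g)=xy\#\delta_h\delta_g\,\Phi\big(j(x)j(y)j(xy)^{-1}\big),\qquad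 \Delta(x\#\delta_h)=\sum_{l\in H}\big(x\#\delta_{l^{-1}}\big)\otimes \Big(l\cdot x\#\delta_{lh}\,\Phi\big(l\cdot j(x)\,j(l\cdot x)^{-1}\big)\Big).$$ Let $A$ be a Hopf algebra, $R$ a (unital associative) $k$-algebra and $\rho:A\to R$ an algebra map. A factorization of $\rho$ is a triple $(L,q,\varphi)$ with $L$ a Hopf algebra, $q:A\to L$ a surjective Hopf algebra map and $\varphi:L\to R$ an algebra map with $\varphi q=\rho$. The Hopf image of $\rho$ is the final factorization: a factorization $(A_\rho,p,\tilde\rho)$ such that for each factorization $(L,q,\varphi)$ there is a unique Hopf algebra map $f:L\to A_\rho$ with $fq=p$ and $\tilde\rho f=\varphi$. The map $\rho$ is inner faithful if $(A,\mathrm{id}_A,\rho)$ is its Hopf image. Corollary 4.3. Let $R$ be a $k$-algebra and let $\rho:k[\Gamma]\rtimes k^H\to R$ be an algebra map whose restriction to $k^H=1\#k^H$ is inner faithful. Then $$N=\{r\in\Gamma\mid \forall h\in H,\ \exists f\in (k^H)^\times \text{ with } \rho(h\cdot r\#1)=\rho(1\#f)\}$$ is an $H$-stable normal subgroup of $\Gamma$.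 Let $\Phi:N\to(k^H)^\times$ be any map such that $(N,\Phi)$ is a quotient datum and $\rho(r\#1)=\rho(1\#\Phi(r))$ for all $r\in N$ (that is, $(N,\Phi)\in\mathcal E(\rho)$). Then, for any choice of the section $j$, the Hopf image of $\rho$ is isomorphic to $k[\Gamma/N]\rtimes_\Phi k^H$. -/

import Mathlib

open scoped TensorProduct

set_option linter.unusedSectionVars false

universe w

noncomputable section

/-! ### The function Hopf algebra `k^H` of a finite group -/

/-- `k^H`, the `k`-valued functions on `H`. -/
def FunHopf (k H : Type*) : Type _ := H → k

namespace FunHopf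

variable {k H : Type*} [Field k] [Group H]

instance : CommRing (FunHopf k H) := inferInstanceAs (CommRing (H → k))

instance : Algebra k (FunHopf k H) := inferInstanceAs (Algebra k (H → k))

instance : CoeFun (FunHopf k H) (fun _ => H → k) := ⟨fun f => f⟩

/-- The value at `h` of an invertible function, as an invertible scalar. -/
def evalUnit (h : H) : (FunHopf k H)ˣ →* kˣ :=
  Units.map (Pi.evalMonoidHom (fun _ : H => k) h)

theorem evalUnit_val (h : H) (f : (FunHopf k H)ˣ) :
    ((evalUnit h f : kˣ) : k) = (f : FunHopf k H) h := rfl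

variable [Fintype H] [DecidableEq H]

/-- The indicator function `δ_h`. -/
def δ (h : H) : FunHopf k H := fun g => if h = g then 1 else 0

theorem δ_apply (h g : H) : (δ h : FunHopf k H) g = if h = g then 1 else 0 := rfl

/-- The basis of `k^H` formed by the indicator functions `δ_h`. -/
def basis : Module.Basis H k (FunHopf k H) :=
  Module.Basis.ofEquivFun
    { toFun := fun f h => f h
      invFun := fun f => f
      map_add' := fun _ _ => rfl
      map_smul' := fun _ _ => rfl
      left_inv := fun _ => rfl
      right_inv := fun _ => rfl }

theorem basis_apply (h : H) : (basis h : FunHopf k H) = δ h := by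
  refine Module.Basis.apply_eq_iff.2 ?_
  ext g
  change (δ h : FunHopf k H) g = _
  rw [δ_apply, Finsupp.single_apply]

/-- To compare two linear maps on `k^H` it is enough to compare them on indicator functions. -/
theorem hom_ext {M : Type*} [AddCommMonoid M] [Module k M] {f g : FunHopf k H →ₗ[k] M}
    (w : ∀ h, f (δ h) = g (δ h)) : f = g :=
  basis.ext fun h => by rw [basis_apply, w]

theorem δ_mul (g h : H) : (δ g * δ h : FunHopf k H) = if g = h then δ g else 0 := by
  funext x
  change (δ g : FunHopf k H) x * (δ h : FunHopf k H) x = _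
  split_ifs with hgh
  · subst hgh
    simp [δ_apply]
  · change _ = (0 : k)
    simp only [δ_apply]
    by_cases h1 : g = x
    · have h2 : h ≠ x := fun h => hgh (h1.trans h.symm)
      simp [h2]
    · simp [h1]

theorem eq_sum (f : FunHopf k H) : f = ∑ h : H, f h • (δ h : FunHopf k H) := by
  have := (Module.Basis.sum_repr (basis : Module.Basis H k (FunHopf k H)) f).symm
  simp only [basis_apply] at this
  exact this

theorem one_eq_sum : (1 : FunHopf k H) = ∑ h : H, δ h := by
  rw [eq_sum (1 : FunHopf k H)]
  exact Finset.sum_congr rfl fun h _ => one_smul k _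

/-- `Δ(δ_h) = ∑_l δ_l ⊗ δ_{l⁻¹h}`, `ε(f) = f(1)`. -/
instance : CoalgebraStruct k (FunHopf k H) where
  comul := basis.constr k fun h => ∑ l : H, δ l ⊗ₜ[k] δ (l⁻¹ * h)
  counit :=
    { toFun := fun f => f 1
      map_add' := fun _ _ => rfl
      map_smul' := fun _ _ => rfl }

theorem comul_δ (h : H) :
    Coalgebra.comul (R := k) (δ h : FunHopf k H) = ∑ l : H, δ l ⊗ₜ[k] δ (l⁻¹ * h) := by
  rw [← basis_apply]
  exact Module.Basis.constr_basis _ _ _ _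

theorem counit_apply (f : FunHopf k H) : Coalgebra.counit (R := k) f = f 1 := rfl

theorem counit_δ (h : H) :
    Coalgebra.counit (R := k) (δ h : FunHopf k H) = if h = 1 then 1 else 0 := δ_apply h 1

instance : Coalgebra k (FunHopf k H) where
  coassoc := by
    refine hom_ext fun h => ?_
    change (TensorProduct.assoc k _ _ _) (LinearMap.rTensor _ Coalgebra.comul
      (Coalgebra.comul (δ h))) = LinearMap.lTensor _ Coalgebra.comul (Coalgebra.comul (δ h))
    simp only [comul_δ, map_sum, LinearMap.rTensor_tmul, LinearMap.lTensor_tmul,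
      TensorProduct.sum_tmul, TensorProduct.tmul_sum, TensorProduct.assoc_tmul]
    rw [Finset.sum_comm]
    refine Finset.sum_congr rfl fun l _ => ?_
    refine Fintype.sum_equiv (Equiv.mulLeft l⁻¹) _ _ fun m => ?_
    simp [mul_assoc]
  rTensor_counit_comp_comul := by
    refine hom_ext fun h => ?_
    change LinearMap.rTensor _ Coalgebra.counit (Coalgebra.comul (δ h)) = 1 ⊗ₜ[k] δ h
    simp only [comul_δ, map_sum, LinearMap.rTensor_tmul, counit_δ]
    rw [Finset.sum_eq_single 1] <;> simp +contextual
  lTensor_counit_comp_comul := by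
    refine hom_ext fun h => ?_
    change LinearMap.lTensor _ Coalgebra.counit (Coalgebra.comul (δ h)) = δ h ⊗ₜ[k] 1
    simp only [comul_δ, map_sum, LinearMap.lTensor_tmul, counit_δ]
    rw [Finset.sum_eq_single h]
    · simp
    · intro l _ hl
      have : l⁻¹ * h ≠ 1 := fun e => hl (inv_mul_eq_one.mp e)
      simp [this]
    · simp

instance : Bialgebra k (FunHopf k H) :=
  Bialgebra.mk' k (FunHopf k H) rfl (fun {_ _} => rfl)
    (by
      rw [one_eq_sum, map_sum]
      simp only [comul_δ]
      rw [Algebra.TensorProduct.one_def, one_eq_sum]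
      simp only [TensorProduct.sum_tmul, TensorProduct.tmul_sum]
      rw [Finset.sum_comm]
      conv_rhs => rw [Finset.sum_comm]
      refine Finset.sum_congr rfl fun l _ => ?_
      exact Fintype.sum_equiv (Equiv.mulLeft l⁻¹) _ _ fun m => rfl)
    (by
      intro a b
      have key : (LinearMap.mul k (FunHopf k H)).compr₂ Coalgebra.comul =
          (LinearMap.mul k (FunHopf k H ⊗[k] FunHopf k H)).compl₁₂
            Coalgebra.comul Coalgebra.comul := by
        refine hom_ext fun g => hom_ext fun h => ?_
        simp only [LinearMap.compr₂_apply, LinearMap.compl₁₂_apply, LinearMap.mul_apply']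
        rw [δ_mul]
        simp only [comul_δ, Finset.sum_mul_sum, Algebra.TensorProduct.tmul_mul_tmul, δ_mul]
        split_ifs with hgh
        · subst hgh
          rw [comul_δ]
          refine Finset.sum_congr rfl fun l _ => ?_
          rw [Finset.sum_eq_single l]
          · simp
          · intro m _ hm
            simp [hm.symm]
          · simp
        · rw [map_zero]
          symm
          refine Finset.sum_eq_zero fun l _ => Finset.sum_eq_zero fun m _ => ?_
          split_ifs with h1 h2
          · subst h1
            exact absurd (mul_left_cancel h2) hgh
          all_goals simp
      exact congrArg (fun F => F a b) key)

/-- The antipode `S(f)(h) = f(h⁻¹)`. -/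
def antipodeAux : FunHopf k H →ₗ[k] FunHopf k H where
  toFun := fun f h => f h⁻¹
  map_add' := fun _ _ => rfl
  map_smul' := fun _ _ => rfl

theorem antipodeAux_δ (h : H) : antipodeAux (δ h : FunHopf k H) = δ h⁻¹ := by
  funext g
  change (δ h : FunHopf k H) g⁻¹ = _
  simp only [δ_apply, ← inv_eq_iff_eq_inv]

instance : HopfAlgebra k (FunHopf k H) where
  antipode := antipodeAux
  mul_antipode_rTensor_comul := by
    refine hom_ext fun h => ?_
    rw [LinearMap.comp_apply, LinearMap.comp_apply, LinearMap.comp_apply, comul_δ, counit_δ,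
      Algebra.linearMap_apply]
    simp only [ map_sum, LinearMap.rTensor_tmul, LinearMap.mul'_apply, antipodeAux_δ, δ_mul]
    rw [Finset.sum_congr rfl (g := fun l : H => if h = 1 then (δ l⁻¹ : FunHopf k H) else 0)]
    · split_ifs
      · rw [map_one, one_eq_sum]
        exact Fintype.sum_equiv (Equiv.inv H) _ _ fun m => rfl
      · simp
    · intro l _
      simp
  mul_antipode_lTensor_comul := by
    refine hom_ext fun h => ?_
    rw [LinearMap.comp_apply, LinearMap.comp_apply, LinearMap.comp_apply, comul_δ, counit_δ,
      Algebra.linearMap_apply]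
    simp only [ map_sum, LinearMap.lTensor_tmul, LinearMap.mul'_apply, antipodeAux_δ, δ_mul]
    rw [Finset.sum_congr rfl (g := fun l : H => if h = 1 then (δ l : FunHopf k H) else 0)]
    · split_ifs
      · rw [map_one, one_eq_sum]
      · simp
    · intro l _
      have : (l = (l⁻¹ * h)⁻¹) ↔ h = 1 := by
        rw [mul_inv_rev, inv_inv, eq_comm, mul_eq_right, inv_eq_one]
      simp only [this]

end FunHopf

/-! ### Hopf algebras `k[X] # k^H` with cocycles

Both the smash coproduct `k[Γ] ⋊ k^H` and the Hopf algebras `k[Γ/N] ⋊_Φ k^H` have a linear basis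
`x # δ_h` with `x` in a group and `h ∈ H`, and structure maps of the same shape, given by scalars
`σ x y h` (for the multiplication) and `τ l x h` (for the comultiplication).  The Hopf algebra
axioms are checked once, from the identities that these scalars satisfy; the two Hopf algebras are
then obtained by exhibiting the scalars. -/

/-- An action of `H` on the group `X` by automorphisms, with scalars `σ x y h` and `τ l x h`
satisfying the identities that make the formulas
`(x # δ_h)(y # δ_g) = σ x y h • xy # δ_h δ_g`,
`Δ(x # δ_h) = ∑_l τ l x h • (x # δ_{l⁻¹}) ⊗ (l.x # δ_{lh})`
into a Hopf algebra. -/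
structure BismashData (k X H : Type*) [Field k] [Group X] [Group H] where
  act : H →* MulAut X
  σ : X → X → H → kˣ
  τ : H → X → H → kˣ
  σ_assoc : ∀ x y z h, σ x y h * σ (x * y) z h = σ y z h * σ x (y * z) h
  σ_one_left : ∀ x h, σ 1 x h = 1
  σ_one_right : ∀ x h, σ x 1 h = 1
  σ_eval_one : ∀ x y, σ x y 1 = 1
  τ_coassoc : ∀ l m x h,
    τ l x h * τ m (act l x) (l * h) = τ (m * l) x h * τ l x (l⁻¹ * m⁻¹)
  τ_one_left : ∀ x h, τ 1 x h = 1
  τ_inv_left : ∀ x h, τ h⁻¹ x h = 1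
  τ_one : ∀ l h, τ l 1 h = 1
  σ_τ : ∀ l x y h, σ x y h * τ l (x * y) h =
    τ l x h * τ l y h * (σ x y l⁻¹ * σ (act l x) (act l y) (l * h))

/-- The vector space with basis `x # δ_h`, for `x ∈ X` and `h ∈ H`. -/
def Bismash {k X H : Type*} [Field k] [Group X] [Group H] (_ : BismashData k X H) : Type _ :=
  X × H →₀ k

namespace Bismash

variable {k X H : Type*} [Field k] [Group X] [Group H] {D : BismashData k X H}

instance : AddCommGroup (Bismash D) := inferInstanceAs (AddCommGroup (X × H →₀ k))

instance : Module k (Bismash D) := inferInstanceAs (Module k (X × H →₀ k))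

/-- The basis `x # δ_h`. -/
def basis : Module.Basis (X × H) k (Bismash D) := Module.Basis.ofRepr (LinearEquiv.refl k _)

/-- The basis element `x # δ_h`. -/
def b (x : X) (h : H) : Bismash D := basis (x, h)

theorem hom_ext {M : Type*} [AddCommMonoid M] [Module k M] {f g : Bismash D →ₗ[k] M}
    (w : ∀ x h, f (b x h) = g (b x h)) : f = g :=
  basis.ext fun p => w p.1 p.2

theorem induction {P : Bismash D → Prop} (p : Bismash D) (zero : P 0)
    (add : ∀ p q, P p → P q → P (p + q)) (smul : ∀ (c : k) p, P p → P (c • p))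
    (base : ∀ x h, P (b x h)) : P p := by
  refine Submodule.span_induction (p := fun x _ => P x) (R := k) (s := Set.range basis) ?_ zero
    (fun x y _ _ => add x y) (fun c x _ => smul c x) (basis.mem_span p)
  rintro _ ⟨⟨x, h⟩, rfl⟩
  exact base x h

/-- The linear map with prescribed values on the elements `x # δ_h`. -/
def lift {M : Type*} [AddCommMonoid M] [Module k M] (F : X → H → M) : Bismash D →ₗ[k] M :=
  basis.constr k fun p => F p.1 p.2

theorem lift_b {M : Type*} [AddCommMonoid M] [Module k M] (F : X → H → M) (x : X) (h : H) :
    lift F (b x h : Bismash D) = F x h :=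
  Module.Basis.constr_basis _ _ _ _

variable [Fintype H] [DecidableEq H]

/-- The multiplication `(x # δ_h)(y # δ_g) = σ x y h • xy # δ_h δ_g`. -/
def mulAux : Bismash D →ₗ[k] Bismash D →ₗ[k] Bismash D :=
  lift fun x h => lift fun y g => if h = g then (D.σ x y h : k) • b (x * y) h else 0

theorem mulAux_b (x y : X) (h g : H) : mulAux (b x h : Bismash D) (b y g) =
    if h = g then (D.σ x y h : k) • b (x * y) h else 0 := by
  rw [mulAux, lift_b, lift_b]

/-- The unit `1 # 1 = ∑_h 1 # δ_h`. -/
def oneAux : Bismash D := ∑ h : H, b 1 h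

theorem mulAux_assoc (p q r : Bismash D) : mulAux (mulAux p q) r = mulAux p (mulAux q r) := by
  induction p using induction with
  | zero => simp
  | add p p' hp hp' => simp [hp, hp']
  | smul c p hp => simp [hp]
  | base x h =>
  induction q using induction with
  | zero => simp
  | add q q' hq hq' => simp [hq, hq']
  | smul c q hq => simp [hq]
  | base y g =>
  induction r using induction with
  | zero => simp
  | add r r' hr hr' => simp [hr, hr']
  | smul c r hr => simp [hr]
  | base z f =>
  rw [mulAux_b, mulAux_b]
  split_ifs with h1 h2 h2
  · subst h1 h2
    rw [map_smul, map_smul, LinearMap.smul_apply, mulAux_b, mulAux_b, if_pos rfl, if_pos rfl,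
      smul_smul, smul_smul, mul_assoc x y z, ← Units.val_mul, ← Units.val_mul, D.σ_assoc]
  · subst h1
    rw [map_smul, LinearMap.smul_apply, mulAux_b, if_neg h2]
    simp
  · subst h2
    rw [map_smul, mulAux_b, if_neg h1]
    simp
  · simp

theorem one_mulAux (p : Bismash D) : mulAux oneAux p = p := by
  have : mulAux (D := D) oneAux = LinearMap.id := by
    refine hom_ext fun x h => ?_
    rw [oneAux, map_sum, LinearMap.sum_apply, Finset.sum_eq_single h]
    · simp [mulAux_b, D.σ_one_left]
    · intro g _ hg
      simp [mulAux_b, hg]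
    · simp
  rw [this, LinearMap.id_apply]

theorem mulAux_one (p : Bismash D) : mulAux p oneAux = p := by
  have : (mulAux (D := D)).flip oneAux = LinearMap.id := by
    refine hom_ext fun x h => ?_
    rw [LinearMap.flip_apply, oneAux, map_sum, Finset.sum_eq_single h]
    · simp [mulAux_b, D.σ_one_right]
    · intro g _ hg
      simp [mulAux_b, hg.symm]
    · simp
  rw [← LinearMap.flip_apply, this, LinearMap.id_apply]

instance : Ring (Bismash D) :=
  { (inferInstance : AddCommGroup (Bismash D)) with
    mul := fun p q => mulAux p q
    one := oneAux
    left_distrib := fun p q r => map_add (mulAux p) q r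
    right_distrib := fun p q r => LinearMap.map_add₂ mulAux p q r
    zero_mul := fun p => LinearMap.map_zero₂ mulAux p
    mul_zero := fun p => map_zero (mulAux p)
    mul_assoc := mulAux_assoc
    one_mul := one_mulAux
    mul_one := mulAux_one }

instance : Algebra k (Bismash D) :=
  Algebra.ofModule (fun c p q => LinearMap.map_smul₂ mulAux c p q)
    (fun c p q => map_smul (mulAux p) c q)

theorem b_mul_b (x y : X) (h g : H) : (b x h * b y g : Bismash D) =
    if h = g then (D.σ x y h : k) • b (x * y) h else 0 :=
  mulAux_b x y h g

theorem one_eq_sum : (1 : Bismash D) = ∑ h : H, b 1 h := rfl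

/-- `Δ(x # δ_h) = ∑_l τ l x h • (x # δ_{l⁻¹}) ⊗ (l.x # δ_{lh})`, `ε(x # δ_h) = δ_{h,1}`. -/
instance : CoalgebraStruct k (Bismash D) where
  comul := lift fun x h => ∑ l : H, (D.τ l x h : k) • (b x l⁻¹ ⊗ₜ[k] b (D.act l x) (l * h))
  counit := lift fun _ h => if h = 1 then 1 else 0

theorem comul_b (x : X) (h : H) : Coalgebra.comul (R := k) (b x h : Bismash D) =
    ∑ l : H, (D.τ l x h : k) • (b x l⁻¹ ⊗ₜ[k] b (D.act l x) (l * h)) :=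
  lift_b _ _ _

theorem counit_b (x : X) (h : H) :
    Coalgebra.counit (R := k) (b x h : Bismash D) = if h = 1 then 1 else 0 :=
  lift_b _ _ _

instance : Coalgebra k (Bismash D) where
  coassoc := by
    refine hom_ext fun x h => ?_
    rw [LinearMap.comp_apply, LinearMap.comp_apply, LinearMap.comp_apply, comul_b]
    simp only [map_sum, map_smul, LinearMap.rTensor_tmul, LinearMap.lTensor_tmul, comul_b,
      TensorProduct.sum_tmul, TensorProduct.tmul_sum, LinearEquiv.coe_coe,
      ← TensorProduct.smul_tmul', TensorProduct.tmul_smul, TensorProduct.assoc_tmul,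
      Finset.smul_sum, smul_smul]
    rw [Finset.sum_comm]
    refine Finset.sum_congr rfl fun l _ => ?_
    refine Fintype.sum_equiv (Equiv.mulRight l⁻¹) _ _ fun n => ?_
    simp only [Equiv.coe_mulRight]
    have e := D.τ_coassoc l (n * l⁻¹) x h
    simp only [mul_inv_rev, inv_inv, inv_mul_cancel_right, inv_mul_cancel_left] at e
    rw [← Units.val_mul, ← Units.val_mul, e, ← MulAut.mul_apply, ← map_mul]
    simp [mul_assoc]
  rTensor_counit_comp_comul := by
    refine hom_ext fun x h => ?_
    rw [LinearMap.comp_apply, comul_b]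
    simp only [map_sum, map_smul, LinearMap.rTensor_tmul, counit_b]
    rw [Finset.sum_eq_single 1]
    · simp [D.τ_one_left]
    · intro l _ hl
      simp [hl]
    · simp
  lTensor_counit_comp_comul := by
    refine hom_ext fun x h => ?_
    rw [LinearMap.comp_apply, comul_b]
    simp only [map_sum, map_smul, LinearMap.lTensor_tmul, counit_b]
    rw [Finset.sum_eq_single h⁻¹]
    · simp [D.τ_inv_left]
    · intro l _ hl
      have : l * h ≠ 1 := fun e => hl (eq_inv_of_mul_eq_one_left e)
      simp [this]
    · simp

theorem comul_mul_b (x y : X) (h g : H) :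
    Coalgebra.comul (R := k) (b x h * b y g : Bismash D) =
      Coalgebra.comul (R := k) (b x h : Bismash D) * Coalgebra.comul (R := k) (b y g) := by
  rw [b_mul_b, comul_b, comul_b]
  simp only [Finset.sum_mul_sum, smul_mul_smul_comm, Algebra.TensorProduct.tmul_mul_tmul, b_mul_b]
  split_ifs with hgh
  · subst hgh
    rw [map_smul, comul_b, Finset.smul_sum]
    refine Finset.sum_congr rfl fun l _ => ?_
    rw [Finset.sum_eq_single l]
    · rw [if_pos rfl, if_pos rfl, TensorProduct.smul_tmul_smul, smul_smul, smul_smul]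
      simp only [← Units.val_mul, D.σ_τ, map_mul]
    · intro m _ hm
      simp [hm.symm]
    · simp
  · rw [map_zero]
    symm
    refine Finset.sum_eq_zero fun l _ => Finset.sum_eq_zero fun m _ => ?_
    split_ifs with h1 h2
    · rw [inv_inj] at h1
      subst h1
      exact absurd (mul_left_cancel h2) hgh
    all_goals simp

instance : Bialgebra k (Bismash D) :=
  Bialgebra.mk' k (Bismash D)
    (by
      rw [one_eq_sum, map_sum, Finset.sum_eq_single 1]
      · simp [counit_b]
      · intro h _ hh
        simp [counit_b, hh]
      · simp)
    (by
      intro p q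
      have key : (LinearMap.mul k (Bismash D)).compr₂ Coalgebra.counit =
          (LinearMap.mul k k).compl₁₂ Coalgebra.counit Coalgebra.counit := by
        refine hom_ext fun x h => hom_ext fun y g => ?_
        simp only [LinearMap.compr₂_apply, LinearMap.compl₁₂_apply, LinearMap.mul_apply']
        rw [b_mul_b, counit_b, counit_b]
        by_cases hh : h = 1
        · subst hh
          by_cases hg : g = 1
          · subst hg
            simp [counit_b, D.σ_eval_one]
          · simp [hg, Ne.symm hg]
        · split_ifs <;> simp [counit_b, hh]
      exact congrArg (fun F => F p q) key)
    (by
      rw [one_eq_sum, map_sum]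
      simp only [comul_b, D.τ_one, map_one, Units.val_one, one_smul]
      rw [Algebra.TensorProduct.one_def, one_eq_sum]
      simp only [TensorProduct.sum_tmul, TensorProduct.tmul_sum]
      rw [Finset.sum_comm]
      conv_rhs => rw [Finset.sum_comm]
      refine Fintype.sum_equiv (Equiv.inv H) _ _ fun l => ?_
      exact Fintype.sum_equiv (Equiv.mulLeft l) _ _ fun m => rfl)
    (by
      intro p q
      have key : (LinearMap.mul k (Bismash D)).compr₂ Coalgebra.comul =
          (LinearMap.mul k (Bismash D ⊗[k] Bismash D)).compl₁₂
            Coalgebra.comul Coalgebra.comul := by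
        refine hom_ext fun x h => hom_ext fun y g => ?_
        simp only [LinearMap.compr₂_apply, LinearMap.compl₁₂_apply, LinearMap.mul_apply']
        exact comul_mul_b x y h g
      exact congrArg (fun F => F p q) key)

/-- The antipode: `S(x # δ_h)` is a scalar multiple of `h⁻¹.x⁻¹ # δ_{h⁻¹}`. -/
def antipodeAux : Bismash D →ₗ[k] Bismash D :=
  lift fun x h =>
    (((D.τ h⁻¹ x 1 * D.σ (D.act h⁻¹ x⁻¹) (D.act h⁻¹ x) h⁻¹)⁻¹ : kˣ) : k) •
      b (D.act h⁻¹ x⁻¹) h⁻¹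

theorem antipodeAux_b (x : X) (h : H) : antipodeAux (b x h : Bismash D) =
    (((D.τ h⁻¹ x 1 * D.σ (D.act h⁻¹ x⁻¹) (D.act h⁻¹ x) h⁻¹)⁻¹ : kˣ) : k) •
      b (D.act h⁻¹ x⁻¹) h⁻¹ :=
  lift_b _ _ _

theorem σ_inv_comm (D : BismashData k X H) (x : X) (h : H) : D.σ x⁻¹ x h = D.σ x x⁻¹ h := by
  have := D.σ_assoc x x⁻¹ x h
  rw [mul_inv_cancel, inv_mul_cancel, D.σ_one_left, D.σ_one_right, mul_one, mul_one] at this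
  exact this.symm

theorem τ_act_one (D : BismashData k X H) (l : H) (x : X) :
    D.τ l⁻¹ (D.act l x) 1 = D.τ l x 1 := by
  have := D.τ_coassoc l l⁻¹ x l⁻¹
  rw [mul_inv_cancel, inv_mul_cancel, inv_inv, inv_mul_cancel, D.τ_one_left, one_mul] at this
  have e := D.τ_inv_left x l⁻¹
  rw [inv_inv] at e
  rwa [e, one_mul] at this

instance : HopfAlgebra k (Bismash D) where
  antipode := antipodeAux
  mul_antipode_rTensor_comul := by
    refine hom_ext fun x h => ?_
    rw [LinearMap.comp_apply, LinearMap.comp_apply, LinearMap.comp_apply, comul_b, counit_b,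
      Algebra.linearMap_apply]
    simp only [map_sum, map_smul, LinearMap.rTensor_tmul, LinearMap.mul'_apply, antipodeAux_b,
      inv_inv, smul_mul_assoc, b_mul_b, ← map_mul, inv_mul_cancel, map_one]
    split_ifs with hh
    · subst hh
      rw [map_one, one_eq_sum]
      refine Finset.sum_congr rfl fun l _ => ?_
      rw [if_pos (mul_one l).symm, smul_smul, smul_smul, ← Units.val_mul, ← Units.val_mul]
      simp
    · rw [map_zero]
      refine Finset.sum_eq_zero fun l _ => ?_
      rw [if_neg (fun e => hh (mul_eq_left.mp e.symm)), smul_zero, smul_zero]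
  mul_antipode_lTensor_comul := by
    refine hom_ext fun x h => ?_
    rw [LinearMap.comp_apply, LinearMap.comp_apply, LinearMap.comp_apply, comul_b, counit_b,
      Algebra.linearMap_apply]
    simp only [map_sum, map_smul, LinearMap.lTensor_tmul, LinearMap.mul'_apply, antipodeAux_b,
      mul_smul_comm, b_mul_b]
    split_ifs with hh
    · subst hh
      rw [map_one, one_eq_sum]
      refine Fintype.sum_equiv (Equiv.inv H) _ _ fun l => ?_
      have e1 : D.act l⁻¹ (D.act l x) = x := by
        rw [← MulAut.mul_apply, ← map_mul, inv_mul_cancel, map_one, MulAut.one_apply]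
      have e2 : D.act l⁻¹ (D.act l x)⁻¹ = x⁻¹ := by rw [map_inv, e1]
      simp only [mul_one, e1, e2, τ_act_one, σ_inv_comm, mul_inv_cancel, Equiv.inv_apply]
      rw [if_pos trivial, smul_smul, smul_smul, ← Units.val_mul, ← Units.val_mul]
      simp
    · rw [map_zero]
      refine Finset.sum_eq_zero fun l _ => ?_
      have : ¬ l⁻¹ = (l * h)⁻¹ := fun e => hh (mul_eq_left.mp (inv_injective e).symm)
      rw [if_neg this, smul_zero, smul_zero]

theorem antipode_b (x : X) (h : H) : HopfAlgebra.antipode k (b x h : Bismash D) =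
    (((D.τ h⁻¹ x 1 * D.σ (D.act h⁻¹ x⁻¹) (D.act h⁻¹ x) h⁻¹)⁻¹ : kˣ) : k) •
      b (D.act h⁻¹ x⁻¹) h⁻¹ :=
  antipodeAux_b x h

end Bismash

/-! ### The smash coproduct `k[Γ] ⋊ k^H` -/

section Smash

variable (k Γ H : Type*) [Field k] [Group Γ] [Group H] [MulDistribMulAction H Γ]

/-- The smash coproduct data: all scalars are trivial. -/
def smashData : BismashData k Γ H where
  act := MulDistribMulAction.toMulAut H Γ
  σ := fun _ _ _ => 1
  τ := fun _ _ _ => 1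
  σ_assoc := fun _ _ _ _ => rfl
  σ_one_left := fun _ _ => rfl
  σ_one_right := fun _ _ => rfl
  σ_eval_one := fun _ _ => rfl
  τ_coassoc := fun _ _ _ _ => rfl
  τ_one_left := fun _ _ => rfl
  τ_inv_left := fun _ _ => rfl
  τ_one := fun _ _ => rfl
  σ_τ := fun _ _ _ _ => by simp

/-- The smash coproduct Hopf algebra `k[Γ] ⋊ k^H`, with basis `r # δ_h = Bismash.b r h`. -/
abbrev SmashCoproduct : Type _ := Bismash (smashData k Γ H)

end Smash

namespace SmashCoproduct

variable {k Γ H : Type*} [Field k] [Group Γ] [Group H] [MulDistribMulAction H Γ]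
  [Fintype H] [DecidableEq H]

/-- As an algebra, `k[Γ] ⋊ k^H` is `k[Γ] ⊗ k^H`. -/
theorem b_mul_b (r s : Γ) (h g : H) : (Bismash.b r h * Bismash.b s g : SmashCoproduct k Γ H) =
    if h = g then Bismash.b (r * s) h else 0 := by
  rw [Bismash.b_mul_b]
  exact if_congr Iff.rfl (one_smul k _) rfl

theorem comul_b (r : Γ) (h : H) :
    Coalgebra.comul (R := k) (Bismash.b r h : SmashCoproduct k Γ H) =
      ∑ l : H, Bismash.b r l⁻¹ ⊗ₜ[k] Bismash.b (l • r) (l * h) := by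
  rw [Bismash.comul_b]
  exact Finset.sum_congr rfl fun l _ => one_smul k _

theorem antipode_b (r : Γ) (h : H) :
    HopfAlgebra.antipode k (Bismash.b r h : SmashCoproduct k Γ H) =
      Bismash.b (h⁻¹ • r⁻¹) h⁻¹ := by
  rw [Bismash.antipode_b]
  have e : ((1 * 1 : kˣ)⁻¹ : kˣ) = 1 := by simp
  change (((1 * 1 : kˣ)⁻¹ : kˣ) : k) • _ = _
  rw [e]
  exact one_smul k _

/-- The element `r # f = ∑_h f(h) r # δ_h`. -/
def elt (r : Γ) (f : FunHopf k H) : SmashCoproduct k Γ H := ∑ h : H, f h • Bismash.b r h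

theorem elt_mul_elt (r s : Γ) (f g : FunHopf k H) :
    (elt r f * elt s g : SmashCoproduct k Γ H) = elt (r * s) (f * g) := by
  unfold elt
  rw [Finset.sum_mul_sum]
  refine Finset.sum_congr rfl fun h _ => ?_
  rw [Finset.sum_eq_single h]
  · rw [smul_mul_smul_comm, b_mul_b, if_pos rfl]
    rfl
  · intro g' _ hg
    rw [smul_mul_smul_comm, b_mul_b, if_neg hg.symm, smul_zero]
  · simp

theorem elt_one_one : (elt 1 1 : SmashCoproduct k Γ H) = 1 := by
  rw [Bismash.one_eq_sum]
  exact Finset.sum_congr rfl fun h _ => one_smul k _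

/-- The inclusion `k^H → k[Γ] ⋊ k^H`, `f ↦ 1 # f`. -/
def incl (k Γ H : Type*) [Field k] [Group Γ] [Group H] [MulDistribMulAction H Γ]
    [Fintype H] [DecidableEq H] : FunHopf k H →ₐ[k] SmashCoproduct k Γ H :=
  AlgHom.ofLinearMap
    { toFun := fun f => elt 1 f
      map_add' := fun f g => by
        unfold elt
        rw [← Finset.sum_add_distrib]
        exact Finset.sum_congr rfl fun h _ => add_smul _ _ _
      map_smul' := fun c f => by
        unfold elt
        rw [Finset.smul_sum]
        exact Finset.sum_congr rfl fun h _ => mul_smul _ _ _ }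
    elt_one_one
    (fun f g => by
      change elt 1 (f * g) = (elt 1 f * elt 1 g : SmashCoproduct k Γ H)
      rw [elt_mul_elt, mul_one])

end SmashCoproduct

/-! ### Quotient data and the Hopf algebras `k[Γ/N] ⋊_Φ k^H` -/

/-- A quotient datum `(N, Φ) = (H, N, Φ)` for `H ↷ Γ` whose first component is the whole
group `H`: a normal `H`-stable subgroup `N` of `Γ` with a group morphism `Φ : N → (k^H)ˣ` such that
`Φ(r)(lh) = Φ(l⁻¹.r)(h) Φ(r)(l)` and `Φ(r) = Φ(s r s⁻¹)`. -/
structure QuotientDatum (k Γ H : Type*) [Field k] [Group Γ] [Group H]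
    [MulDistribMulAction H Γ] where
  N : Subgroup Γ
  normal : N.Normal
  stable : ∀ (h : H), ∀ r ∈ N, h • r ∈ N
  Φ : N →* (FunHopf k H)ˣ
  Φ_mul : ∀ (r : N) (l h : H), (Φ r : FunHopf k H) (l * h) =
    (Φ ⟨l⁻¹ • (r : Γ), stable l⁻¹ r r.2⟩ : FunHopf k H) h * (Φ r : FunHopf k H) l
  Φ_conj : ∀ (r : N) (s : Γ), Φ r = Φ ⟨s * r * s⁻¹, normal.conj_mem r r.2 s⟩

/-- A section `j : Γ/N → Γ` of the canonical projection with `j(1) = 1`. -/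
structure NormalizedSection {Γ : Type*} [Group Γ] (N : Subgroup Γ) where
  toFun : Γ ⧸ N → Γ
  mk_toFun : ∀ x, (toFun x : Γ ⧸ N) = x
  map_one : toFun ((1 : Γ) : Γ ⧸ N) = 1

instance {Γ : Type*} [Group Γ] (N : Subgroup Γ) : CoeFun (NormalizedSection N)
    (fun _ => Γ ⧸ N → Γ) := ⟨NormalizedSection.toFun⟩

instance {Γ : Type*} [Group Γ] (N : Subgroup Γ) : Nonempty (NormalizedSection N) := by
  classical
  refine ⟨⟨fun x => if x = ((1 : Γ) : Γ ⧸ N) then 1 else x.out, fun x => ?_, if_pos rfl⟩⟩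
  split_ifs with h
  · exact h.symm
  · exact Quotient.out_eq' x

namespace QuotientDatum

variable {k Γ H : Type*} [Field k] [Group Γ] [Group H] [MulDistribMulAction H Γ]
  (D : QuotientDatum k Γ H)

instance : D.N.Normal := D.normal

/-- The action of `H` on `Γ/N`: `l.u(r) = u(l.r)`. -/
def act : H →* MulAut (Γ ⧸ D.N) where
  toFun l := MonoidHom.toMulEquiv
    (QuotientGroup.map D.N D.N (MulDistribMulAction.toMonoidHom Γ l) (D.stable l))
    (QuotientGroup.map D.N D.N (MulDistribMulAction.toMonoidHom Γ l⁻¹) (D.stable l⁻¹))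
    (by
      ext r
      change ((l⁻¹ • l • r : Γ) : Γ ⧸ D.N) = r
      rw [inv_smul_smul])
    (by
      ext r
      change ((l • l⁻¹ • r : Γ) : Γ ⧸ D.N) = r
      rw [smul_inv_smul])
  map_one' := by
    ext x
    induction x using QuotientGroup.induction_on with
    | H r =>
      change (((1 : H) • r : Γ) : Γ ⧸ D.N) = r
      rw [one_smul]
  map_mul' l m := by
    ext x
    induction x using QuotientGroup.induction_on with
    | H r =>
      change (((l * m) • r : Γ) : Γ ⧸ D.N) = ((l • m • r : Γ) : Γ ⧸ D.N)
      rw [mul_smul]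

theorem act_mk (l : H) (r : Γ) : D.act l (r : Γ ⧸ D.N) = ((l • r : Γ) : Γ ⧸ D.N) := rfl

/-- The scalar `Φ(n)(h)`, for `n ∈ N`. -/
def φ (h : H) (n : Γ) (hn : n ∈ D.N) : kˣ := FunHopf.evalUnit h (D.Φ ⟨n, hn⟩)

theorem φ_congr {h : H} {n m : Γ} (hn : n ∈ D.N) (e : n = m) :
    D.φ h n hn = D.φ h m (e ▸ hn) := by
  subst e; rfl

theorem φ_mul_φ {h : H} {n m : Γ} (hn : n ∈ D.N) (hm : m ∈ D.N) :
    D.φ h n hn * D.φ h m hm = D.φ h (n * m) (mul_mem hn hm) := by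
  unfold φ
  rw [← map_mul, ← map_mul]
  rfl

theorem φ_conj {h : H} {n : Γ} (hn : n ∈ D.N) (s : Γ) :
    D.φ h n hn = D.φ h (s * n * s⁻¹) (D.normal.conj_mem n hn s) := by
  unfold φ
  rw [D.Φ_conj ⟨n, hn⟩ s]

theorem φ_smul {l h : H} {n : Γ} (hn : n ∈ D.N) :
    D.φ (l * h) n hn = D.φ h (l⁻¹ • n) (D.stable l⁻¹ n hn) * D.φ l n hn :=
  Units.ext (D.Φ_mul ⟨n, hn⟩ l h)

theorem φ_eq_smul (m : H) {h : H} {n : Γ} (hn : n ∈ D.N) :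
    D.φ h n hn = D.φ (m * h) (m • n) (D.stable m n hn) * D.φ m⁻¹ n hn := by
  have e := D.φ_smul (l := m⁻¹) (h := m * h) hn
  rw [D.φ_congr (D.stable m⁻¹⁻¹ n hn) (by rw [inv_inv] : m⁻¹⁻¹ • n = m • n)] at e
  rw [← e]
  congr 1
  group

theorem φ_one {h : H} (h1 : (1 : Γ) ∈ D.N) : D.φ h 1 h1 = 1 := by
  have := D.φ_mul_φ (h := h) h1 h1
  rw [D.φ_congr (mul_mem h1 h1) (mul_one 1)] at this
  exact mul_eq_left.mp this

theorem φ_eval_one {n : Γ} (hn : n ∈ D.N) : D.φ 1 n hn = 1 := by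
  have := D.φ_smul (l := 1) (h := 1) hn
  rw [D.φ_congr (D.stable 1⁻¹ n hn) (by simp : (1 : H)⁻¹ • n = n)] at this
  rw [mul_one] at this
  exact mul_eq_left.mp this.symm

variable (j : NormalizedSection D.N)

theorem σ_mem (x y : Γ ⧸ D.N) : j x * j y * (j (x * y))⁻¹ ∈ D.N := by
  rw [← QuotientGroup.eq_one_iff]
  simp [j.mk_toFun]

theorem τ_mem (l : H) (x : Γ ⧸ D.N) : l • j x * (j (D.act l x))⁻¹ ∈ D.N := by
  rw [← QuotientGroup.eq_one_iff, QuotientGroup.mk_mul, ← D.act_mk]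
  simp [j.mk_toFun]

/-- The scalars `σ x y h = Φ(j(x) j(y) j(xy)⁻¹)(h)` and `τ l x h = Φ(l.j(x) j(l.x)⁻¹)(lh)`. -/
def bismashData : BismashData k (Γ ⧸ D.N) H where
  act := D.act
  σ := fun x y h => D.φ h (j x * j y * (j (x * y))⁻¹) (D.σ_mem j x y)
  τ := fun l x h => D.φ (l * h) (l • j x * (j (D.act l x))⁻¹) (D.τ_mem j l x)
  σ_assoc := fun x y z h => by
    rw [D.φ_conj (D.σ_mem j y z) (j x), φ_mul_φ, φ_mul_φ]
    apply φ_congr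
    rw [mul_assoc x y z]
    group
  σ_one_left := fun x h => by
    rw [D.φ_congr _ (m := 1), φ_one]
    have : j (1 : Γ ⧸ D.N) = 1 := j.map_one
    simp [this]
  σ_one_right := fun x h => by
    rw [D.φ_congr _ (m := 1), φ_one]
    have : j (1 : Γ ⧸ D.N) = 1 := j.map_one
    simp [this]
  σ_eval_one := fun x y => D.φ_eval_one _
  τ_coassoc := fun l m x h => by
    rw [D.φ_eq_smul m (D.τ_mem j l x), mul_right_comm, φ_mul_φ, mul_assoc m l h,
      mul_inv_cancel_left]
    congr 1
    apply φ_congr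
    rw [map_mul, MulAut.mul_apply, smul_mul', smul_inv', mul_smul]
    group
  τ_one_left := fun x h => by
    rw [D.φ_congr _ (m := 1), φ_one]
    simp
  τ_inv_left := fun x h => by
    simp only [inv_mul_cancel]
    exact D.φ_eval_one _
  τ_one := fun l h => by
    rw [D.φ_congr _ (m := 1), φ_one]
    have : j (1 : Γ ⧸ D.N) = 1 := j.map_one
    simp [this]
  σ_τ := fun l x y h => by
    rw [D.φ_eq_smul l (D.σ_mem j x y), mul_right_comm, φ_mul_φ,
      D.φ_conj (D.τ_mem j l y) (j (D.act l x)), φ_mul_φ,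
      mul_comm (D.φ l⁻¹ _ _) (D.φ (l * h) _ _), ← mul_assoc (D.φ _ _ _),
      φ_mul_φ]
    congr 1
    apply φ_congr
    simp only [smul_mul', smul_inv', map_mul]
    group

/-- The Hopf algebra `k[Γ/N] ⋊_Φ k^H` of a quotient datum, built with the section `j`.  On the basis
`x # δ_h` (`x ∈ Γ/N`, `h ∈ H`) its structure maps are
`(x # δ_h)(y # δ_g) = xy # δ_h δ_g Φ(j(x) j(y) j(xy)⁻¹)` and
`Δ(x # δ_h) = ∑_l (x # δ_{l⁻¹}) ⊗ (l.x # δ_{lh} Φ(l.j(x) j(l.x)⁻¹))`,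
with unit `∑_h 1 # δ_h` and counit `ε(x # δ_h) = δ_{h,1}`. -/
abbrev TwistedSmash : Type _ := Bismash (D.bismashData j)

variable [Fintype H] [DecidableEq H]

theorem b_mul_b (x y : Γ ⧸ D.N) (h g : H) :
    (Bismash.b x h * Bismash.b y g : D.TwistedSmash j) =
      if h = g then (D.Φ ⟨j x * j y * (j (x * y))⁻¹, D.σ_mem j x y⟩ : FunHopf k H) h •
        Bismash.b (x * y) h else 0 :=
  Bismash.b_mul_b x y h g

theorem comul_b (x : Γ ⧸ D.N) (h : H) :
    Coalgebra.comul (R := k) (Bismash.b x h : D.TwistedSmash j) =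
      ∑ l : H, (D.Φ ⟨l • j x * (j (D.act l x))⁻¹, D.τ_mem j l x⟩ : FunHopf k H) (l * h) •
        (Bismash.b x l⁻¹ ⊗ₜ[k] Bismash.b (D.act l x) (l * h)) :=
  Bismash.comul_b x h

end QuotientDatum

/-! ### Hopf images -/

section HopfImage

variable {k A L R : Type*} [Field k] [Ring A] [HopfAlgebra k A] [Ring L] [HopfAlgebra k L]
  [Ring R] [Algebra k R]

/-- `(L, q, φ)` is a factorization of the algebra map `ρ : A → R`: `q : A → L` is a surjective map
of Hopf algebras and `φ : L → R` an algebra map with `φ q = ρ`.  (A bialgebra map between Hopf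
algebras commutes with the antipodes.) -/
structure IsHopfFactorization (ρ : A →ₐ[k] R) (q : A →ₐc[k] L) (φ : L →ₐ[k] R) : Prop where
  surjective : Function.Surjective q
  comp_eq : φ.comp (q : A →ₐ[k] L) = ρ

/-- `(L, p, ρ')` is the Hopf image of `ρ`: it is a final object among the factorizations
`(L', q, φ)` of `ρ`, where `L'` ranges over the Hopf algebras in `Type w`. -/
def IsHopfImage (ρ : A →ₐ[k] R) (p : A →ₐc[k] L) (ρ' : L →ₐ[k] R) : Prop :=
  IsHopfFactorization ρ p ρ' ∧
    ∀ (L' : Type w) [Ring L'] [HopfAlgebra k L'] (q : A →ₐc[k] L') (φ : L' →ₐ[k] R),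
      IsHopfFactorization ρ q φ →
        ∃! f : L' →ₐc[k] L, f.comp q = p ∧ ρ'.comp (f : L' →ₐ[k] L) = φ

/-- `ρ` is inner faithful: `(A, id, ρ)` is the Hopf image of `ρ`.  (Every Hopf algebra quotient of
`A` is isomorphic to one in the universe of `A`.) -/
def InnerFaithful {k : Type*} {A : Type w} {R : Type*} [Field k] [Ring A] [HopfAlgebra k A]
    [Ring R] [Algebra k R] (ρ : A →ₐ[k] R) : Prop :=
  IsHopfImage.{w} ρ (BialgHom.id k A) ρ

end HopfImage

section Representation

variable {k Γ H R : Type*} [Field k] [Group Γ] [Group H] [MulDistribMulAction H Γ]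
  [Fintype H] [DecidableEq H] [Ring R] [Algebra k R]

open SmashCoproduct in
/-- The set `𝓔(ρ)` of quotient data `(N, Φ)` with `ρ(r # 1) = ρ(1 # Φ(r))` for all `r ∈ N`. -/
def compatibleData (ρ : SmashCoproduct k Γ H →ₐ[k] R) : Set (QuotientDatum k Γ H) :=
  {D | ∀ r : D.N, ρ (elt (r : Γ) 1) = ρ (elt 1 (D.Φ r : FunHopf k H))}

open SmashCoproduct in
/-- The subgroup of those `r ∈ Γ` such that for all `h ∈ H` there is an invertible `f ∈ k^H` with
`ρ(h.r # 1) = ρ(1 # f)`. -/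
def imageSubgroup (ρ : SmashCoproduct k Γ H →ₐ[k] R) : Subgroup Γ where
  carrier := {r | ∀ h : H, ∃ f : (FunHopf k H)ˣ,
    ρ (elt (h • r) 1) = ρ (elt 1 (f : FunHopf k H))}
  one_mem' := fun h => ⟨1, by rw [smul_one, Units.val_one]⟩
  mul_mem' := by
    intro r s hr hs h
    obtain ⟨f, hf⟩ := hr h
    obtain ⟨g, hg⟩ := hs h
    refine ⟨f * g, ?_⟩
    have e1 := elt_mul_elt (h • r) (h • s) (1 : FunHopf k H) 1
    have e2 := elt_mul_elt (1 : Γ) 1 (f : FunHopf k H) g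
    rw [mul_one] at e1 e2
    rw [smul_mul', ← e1, Units.val_mul, ← e2, map_mul, map_mul, hf, hg]
  inv_mem' := by
    intro r hr h
    obtain ⟨f, hf⟩ := hr h
    refine ⟨f⁻¹, ?_⟩
    have e1 := elt_mul_elt (h • r)⁻¹ (h • r) (1 : FunHopf k H) 1
    have e2 := elt_mul_elt (1 : Γ) 1 (f : FunHopf k H) (f⁻¹ : (FunHopf k H)ˣ)
    rw [inv_mul_cancel, mul_one, elt_one_one] at e1
    rw [Units.mul_inv, mul_one, elt_one_one] at e2
    have d1 := congrArg ρ e1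
    have d2 := congrArg ρ e2
    rw [map_mul, map_one] at d1 d2
    rw [smul_inv']
    rw [hf] at d1
    exact left_inv_eq_right_inv d1 d2

end Representation

end

/-! ### Linear algebra: vectors with `δ v = v ⊗ v` and elementary tensors. -/

section LinearAlgebra

variable {k V W : Type*} [Field k] [AddCommGroup V] [Module k V] [AddCommGroup W] [Module k W]

/-! With `N` the subgroup `imageSubgroup ρ`, the map `proj` is a factorization of `ρ` because `ρ(nr
# δ_h) = Φ(n)(h) ρ(r # δ_h)` for `n ∈ N`. The content is finality: for every factorization `(L, q,
φ)`, the projection `proj` must factor through `q`. As `q` is surjective, a linear map `F` with `F q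
= proj` is enough (`exists_bialgHom_comp_eq`).

The tool is the identity `(δ_g ⊗ δ_g') Δ(r # δ_{gg'}) = (r # δ_g) ⊗ (g⁻¹.r # δ_g')`, pushed into `L`
(`tmul_mul_comul_map_b`). It makes many subsets of `H` multiplicatively closed, and inner
faithfulness on `k^H` says that a submonoid outside which `ρ(1 # δ_h)` vanishes is all of `H`
(`FunHopf.mem_of_innerFaithful`). This gives first that no `q(1 # δ_h)` is zero. Next let `M` be the
set of `r` with `q(r # δ_1) = q(1 # δ_1)`. It is `H`-stable, and for `r ∈ M` each `q(r # δ_h)` is a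
scalar multiple of `q(1 # δ_h)`. Applying `φ` shows `M ⊆ N`, and the submonoid argument again
identifies the scalar as `Φ(r)(h)` (`map_b_eq_φ_smul`). So the relations that `q` imposes between
elements `r # δ_h` whose `h⁻¹.r` have the same image under `q(· # δ_1)` are already imposed by
`proj`.

There are no others: multiplying the second leg of `Δ(q(r # δ_h))` by `q(1 # δ_1)` leaves `q(r #
δ_h) ⊗ q(h⁻¹.r # δ_1)`. The vectors `q(s # δ_1)` are group-like up to an idempotent, so the distinct
ones are linearly independent and the second leg may select the rule applied to the first. This
defines `F` (`exists_linearMap_comp_eq_proj`). -/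

/-- Nonzero vectors with `δ v = v ⊗ v` are linearly independent. -/
theorem linearIndepOn_of_map_eq_tmul_self (δ : V →ₗ[k] V ⊗[k] V) {S : Set V}
    (hS : ∀ v ∈ S, v ≠ 0) (hδ : ∀ v ∈ S, δ v = v ⊗ₜ[k] v) : LinearIndepOn k id S := by
  classical
  rw [linearIndepOn_iff_linearIndepOn_finset]
  intro s hs
  induction s using Finset.cons_induction with
  | empty => simp
  | cons a s has ih =>
  simp only [Finset.cons_eq_insert, Finset.coe_insert, Set.insert_subset_iff] at hs
  obtain ⟨ha, hs⟩ := hs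
  specialize ih hs
  rw [Finset.coe_cons]
  refine ih.id_insert fun hmem => ?_
  rw [Submodule.mem_span_finset] at hmem
  obtain ⟨c, -, hc⟩ := hmem
  have ih2 := ih.tmul_of_isDomain ih
  simp_rw [← Finset.coe_product, linearIndepOn_finset_iffₛ, id] at ih2
  -- Write `a = ∑ c x • x`. Both sides are `δ a`, computed termwise and as `a ⊗ a`. Independence of
  -- the `x ⊗ y` gives `c x * c y = 0` for `x ≠ y` and `c x ^ 2 = c x`, so `a` is zero or an element
  -- of `s`.
  have key : ∑ x ∈ s, ∑ y ∈ s, (if x = y then c x else 0) • x ⊗ₜ[k] y =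
      ∑ x ∈ s, ∑ y ∈ s, (c x * c y) • x ⊗ₜ[k] y := by
    have h1 : δ (∑ x ∈ s, c x • x) =
        ∑ x ∈ s, ∑ y ∈ s, (if x = y then c x else 0) • x ⊗ₜ[k] y := by
      rw [map_sum]
      refine Finset.sum_congr rfl fun x hx => ?_
      simp [hx, hδ x (hs hx)]
    rw [← h1, hc, hδ a ha, ← hc, TensorProduct.sum_tmul]
    refine Finset.sum_congr rfl fun x _ => ?_
    rw [TensorProduct.tmul_sum]
    exact Finset.sum_congr rfl fun y _ => TensorProduct.smul_tmul_smul _ _ _ _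
  simp_rw [← Finset.sum_product'] at key
  apply ih2 at key
  by_cases hz : ∀ x ∈ s, c x = 0
  · apply hS a ha
    rw [← hc]
    exact Finset.sum_eq_zero fun x hx => by rw [hz x hx, zero_smul]
  · push Not at hz
    obtain ⟨x, hx, hcx⟩ := hz
    have hcy (y) (hys : y ∈ s) (hyx : y ≠ x) : c y = 0 := by
      simpa [*] using (key (y, x) (by simp [*])).symm
    have hc1 : c x = 1 := by
      simpa [hcx] using (key (x, x) (by simp [*])).symm
    rw [Finset.sum_eq_single x (fun y hy hyx => by rw [hcy y hy hyx, zero_smul])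
      (fun h => absurd hx h), hc1, one_smul] at hc
    exact has (hc ▸ hx)

theorem LinearIndepOn.exists_linearMap {S : Set V} (hS : LinearIndepOn k id S) (f : V → W) :
    ∃ T : V →ₗ[k] W, ∀ v ∈ S, T v = f v := by
  refine ⟨(Module.Basis.extend hS).constr k fun v => f v, fun v hv => ?_⟩
  have h := (Module.Basis.extend hS).constr_basis k (fun v => f v)
    ⟨v, hS.subset_extend (Set.subset_univ _) hv⟩
  rwa [Module.Basis.extend_apply_self] at h

theorem exists_dual_apply_eq_one {v : V} (hv : v ≠ 0) : ∃ ω : V →ₗ[k] k, ω v = 1 := by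
  obtain ⟨ω, hω⟩ := (LinearIndepOn.singleton (v := id) (R := k) hv).exists_linearMap
    fun _ => (1 : k)
  exact ⟨ω, hω v rfl⟩

theorem tmul_ne_zero_of_field {v : V} {w : W} (hv : v ≠ 0) (hw : w ≠ 0) : v ⊗ₜ[k] w ≠ 0 := by
  obtain ⟨ω, hω⟩ := exists_dual_apply_eq_one (k := k) hw
  intro h
  apply hv
  simpa [hω] using congrArg (TensorProduct.rid k V ∘ LinearMap.lTensor V ω) h

/-- A functional with value 1 at `w`, applied to the second leg, recovers `v` on the left and a
multiple of `v'` on the right. -/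
theorem exists_smul_of_tmul_eq {v v' : V} {w w' : W} (hw : w ≠ 0)
    (h : v ⊗ₜ[k] w = v' ⊗ₜ[k] w') : ∃ c : k, v = c • v' := by
  obtain ⟨ω, hω⟩ := exists_dual_apply_eq_one (k := k) hw
  refine ⟨ω w', ?_⟩
  have := congrArg (TensorProduct.rid k V ∘ LinearMap.lTensor V ω) h
  simpa [hω] using this

end LinearAlgebra

/-! ### Restriction of functions to a subgroup, and inner faithful maps on `k^H`. -/

namespace FunHopf

variable {k H : Type*} [Field k] [Group H] [Fintype H] [DecidableEq H]

/-- The restriction of functions to a subgroup, as a map of algebras. -/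
def restrictAlgHom (K : Subgroup H) : FunHopf k H →ₐ[k] FunHopf k K where
  toFun := fun f (h : K) => f (h : H)
  map_one' := rfl
  map_mul' := fun _ _ => rfl
  map_zero' := rfl
  map_add' := fun _ _ => rfl
  commutes' := fun _ => rfl

theorem map_eq_of_eqOn {R : Type*} [Ring R] [Algebra k R] {K : Subgroup H}
    {ψ : FunHopf k H →ₐ[k] R} (hψ : ∀ h ∉ K, ψ (δ h) = 0)
    {f g : FunHopf k H} (hfg : ∀ h ∈ K, f h = g h) : ψ f = ψ g := by
  rw [eq_sum f, eq_sum g, map_sum, map_sum]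
  refine Finset.sum_congr rfl fun h _ => ?_
  by_cases hh : h ∈ K
  · rw [hfg h hh]
  · rw [map_smul, map_smul, hψ h hh, smul_zero, smul_zero]

variable (K : Subgroup H) [Fintype K] [DecidableEq K]

theorem restrictAlgHom_δ (h : K) : restrictAlgHom K (δ (h : H) : FunHopf k H) = δ h := by
  funext g
  change (δ (h : H) : FunHopf k H) g = _
  simp only [δ_apply, Subtype.ext_iff]

theorem restrictAlgHom_δ_of_notMem {h : H} (hh : h ∉ K) :
    restrictAlgHom K (δ h : FunHopf k H) = 0 := by
  funext g
  change (δ h : FunHopf k H) g = 0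
  rw [δ_apply, if_neg]
  rintro rfl
  exact hh g.2

/-- The restriction of functions to a subgroup, as a map of bialgebras. -/
noncomputable def restrict : FunHopf k H →ₐc[k] FunHopf k K :=
  BialgHom.ofAlgHom (restrictAlgHom K) (AlgHom.ext fun f => rfl) (by
    apply AlgHom.toLinearMap_injective
    refine hom_ext fun h => ?_
    change Algebra.TensorProduct.map _ _ (Coalgebra.comul (R := k) (δ h)) =
      Coalgebra.comul (R := k) (restrictAlgHom K (δ h : FunHopf k H))
    rw [comul_δ, map_sum]
    simp only [Algebra.TensorProduct.map_tmul]
    have key : ∑ l : H, restrictAlgHom K (δ l : FunHopf k H) ⊗ₜ[k]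
          restrictAlgHom K (δ (l⁻¹ * h) : FunHopf k H) =
        ∑ l : K, (δ l : FunHopf k K) ⊗ₜ[k] restrictAlgHom K (δ ((l : H)⁻¹ * h) : FunHopf k H) := by
      symm
      refine Finset.sum_of_injOn (fun l : K => (l : H)) (fun _ _ _ _ e => Subtype.ext e)
        (fun _ _ => Finset.mem_coe.2 (Finset.mem_univ _)) (fun l _ hl => ?_) (fun l _ => ?_)
      · rw [restrictAlgHom_δ_of_notMem, TensorProduct.zero_tmul]
        exact fun hK => hl ⟨⟨l, hK⟩, Finset.mem_coe.2 (Finset.mem_univ _), rfl⟩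
      · rw [restrictAlgHom_δ]
    rw [key]
    by_cases hh : h ∈ K
    · lift h to K using hh
      rw [restrictAlgHom_δ, comul_δ]
      refine Finset.sum_congr rfl fun l _ => ?_
      rw [← restrictAlgHom_δ K (l⁻¹ * h)]
      rfl
    · rw [restrictAlgHom_δ_of_notMem K hh, map_zero]
      refine Finset.sum_eq_zero fun l _ => ?_
      rw [restrictAlgHom_δ_of_notMem, TensorProduct.tmul_zero]
      exact fun e => hh ((K.mul_mem_cancel_left (K.inv_mem l.2)).1 e))

open Classical in
/-- Extension of functions by zero. -/
noncomputable def extend (f : FunHopf k K) : FunHopf k H :=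
  fun h => if hh : h ∈ K then f ⟨h, hh⟩ else 0

theorem extend_of_mem (f : FunHopf k K) {h : H} (hh : h ∈ K) : extend K f h = f ⟨h, hh⟩ :=
  dif_pos hh

theorem restrict_extend (f : FunHopf k K) : restrict K (extend K f) = f :=
  funext fun h => extend_of_mem K f h.2

variable {K} {R : Type*} [Ring R] [Algebra k R]

/-- The factorization through `k^K` of an algebra map on `k^H` that vanishes on `δ_h`, `h ∉ K`. -/
noncomputable def factorRestrict (ψ : FunHopf k H →ₐ[k] R) (hψ : ∀ h ∉ K, ψ (δ h) = 0) :
    FunHopf k K →ₐ[k] R :=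
  AlgHom.ofLinearMap
    { toFun := fun f => ψ (extend K f)
      map_add' := fun f g => by
        rw [← map_add]
        refine map_eq_of_eqOn hψ fun h hh => ?_
        change _ = extend K f h + extend K g h
        simp only [extend_of_mem K _ hh]
        rfl
      map_smul' := fun c f => by
        rw [RingHom.id_apply, ← map_smul]
        refine map_eq_of_eqOn hψ fun h hh => ?_
        change _ = c • extend K f h
        simp only [extend_of_mem K _ hh]
        rfl }
    (by
      rw [← map_one ψ]
      exact map_eq_of_eqOn hψ fun h hh => extend_of_mem K _ hh)
    (fun f g => by
      change ψ _ = ψ _ * ψ _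
      rw [← map_mul]
      refine map_eq_of_eqOn hψ fun h hh => ?_
      change _ = extend K f h * extend K g h
      simp only [extend_of_mem K _ hh]
      rfl)

/-- If an inner faithful map vanishes on `δ_h` for all `h` outside a submonoid of `H`, then this
submonoid is the whole of `H`. -/
theorem mem_of_innerFaithful {ψ : FunHopf k H →ₐ[k] R} (hψ : InnerFaithful ψ) (K : Submonoid H)
    (h0 : ∀ h ∉ K, ψ (δ h) = 0) (h : H) : h ∈ K := by
  classical
  let K' : Subgroup H :=
    { K with
      inv_mem' := fun {x} hx => by
        have hx' : x ∈ K := hx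
        change x⁻¹ ∈ K
        -- In a finite group the inverse of an element is one of its powers, so a submonoid is a
        -- subgroup.
        obtain ⟨n, hn⟩ := (isOfFinOrder_of_finite x).mem_powers_iff_mem_zpowers.2
          (Subgroup.inv_mem _ (Subgroup.mem_zpowers x))
        exact hn ▸ pow_mem hx' n }
  have h0' : ∀ h ∉ K', ψ (δ h) = 0 := h0
  -- Finality of the identity yields `f` with `f ∘ restrict = id`, whereas restriction kills `δ_h`
  -- for `h` outside the subgroup.
  obtain ⟨f, ⟨hf, -⟩, -⟩ := hψ.2 (FunHopf k K') (restrict K') (factorRestrict ψ h0')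
    ⟨fun g => ⟨extend K' g, restrict_extend K' g⟩, AlgHom.ext fun g =>
      map_eq_of_eqOn h0' fun h hh => extend_of_mem K' _ hh⟩
  by_contra hh
  have e := congrArg (fun F : FunHopf k H →ₐc[k] FunHopf k H => F (δ h)) hf
  have e2 : f (restrict K' (δ h)) = δ h := e
  have e3 : restrict K' (δ h : FunHopf k H) = 0 := restrictAlgHom_δ_of_notMem K' hh
  rw [e3, map_zero] at e2
  have e4 : (0 : k) = (δ h : FunHopf k H) h := congrFun e2 h
  rw [δ_apply, if_pos rfl] at e4
  exact zero_ne_one e4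

end FunHopf

/-! ### Computations in the smash coproduct. -/

namespace SmashCoproduct

variable {k Γ H : Type*} [Field k] [Group Γ] [Group H] [MulDistribMulAction H Γ]
  [Fintype H] [DecidableEq H]

theorem incl_δ (h : H) : incl k Γ H (FunHopf.δ h) = Bismash.b 1 h := by
  change ∑ g : H, (FunHopf.δ h : FunHopf k H) g • Bismash.b 1 g = _
  rw [Finset.sum_eq_single h]
  · rw [FunHopf.δ_apply, if_pos rfl, one_smul]
  · intro g _ hg
    rw [FunHopf.δ_apply, if_neg hg.symm, zero_smul]
  · simp

theorem elt_mul_b (r s : Γ) (f : FunHopf k H) (h : H) :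
    (elt r f * Bismash.b s h : SmashCoproduct k Γ H) = f h • Bismash.b (r * s) h := by
  unfold elt
  rw [Finset.sum_mul, Finset.sum_eq_single h]
  · rw [smul_mul_assoc, b_mul_b, if_pos rfl]
  · intro g _ hg
    rw [smul_mul_assoc, b_mul_b, if_neg hg, smul_zero]
  · simp

theorem counit_b (r : Γ) (h : H) :
    Coalgebra.counit (R := k) (Bismash.b r h : SmashCoproduct k Γ H) = if h = 1 then 1 else 0 :=
  Bismash.counit_b r h

theorem b_mul_b_self (r s : Γ) (h : H) :
    (Bismash.b r h * Bismash.b s h : SmashCoproduct k Γ H) = Bismash.b (r * s) h := by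
  rw [b_mul_b, if_pos rfl]

/-- Cutting `Δ(r # δ_{gg'})` down by the idempotent `δ_g ⊗ δ_{g'}` gives
`(r # δ_g) ⊗ (g⁻¹.r # δ_{g'})`. -/
theorem tmul_mul_comul_b (r : Γ) (g g' : H) :
    (Bismash.b 1 g ⊗ₜ[k] Bismash.b 1 g') *
      Coalgebra.comul (R := k) (Bismash.b r (g * g') : SmashCoproduct k Γ H) =
        Bismash.b r g ⊗ₜ[k] Bismash.b (g⁻¹ • r) g' := by
  rw [comul_b, Finset.mul_sum, Finset.sum_eq_single g⁻¹]
  · rw [Algebra.TensorProduct.tmul_mul_tmul, inv_inv, inv_mul_cancel_left, b_mul_b_self,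
      b_mul_b_self, one_mul, one_mul]
  · intro l _ hl
    rw [Algebra.TensorProduct.tmul_mul_tmul, b_mul_b, if_neg, TensorProduct.zero_tmul]
    exact fun e => hl (by rw [e, inv_inv])
  · simp

end SmashCoproduct

/-! ### The canonical projection onto `k[Γ/N] ⋊_Φ k^H` and the descent of `ρ`. -/

namespace QuotientDatum

open SmashCoproduct

variable {k Γ H : Type*} [Field k] [Group Γ] [Group H] [MulDistribMulAction H Γ]
  (D : QuotientDatum k Γ H) (j : NormalizedSection D.N)

theorem mul_section_inv_mem (r : Γ) : r * (j (r : Γ ⧸ D.N))⁻¹ ∈ D.N := by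
  rw [← QuotientGroup.eq_one_iff]
  simp [j.mk_toFun]

/-- The scalar `Φ(r j(r)⁻¹)(h)`. -/
def projScalar (r : Γ) (h : H) : kˣ :=
  D.φ h (r * (j (r : Γ ⧸ D.N))⁻¹) (D.mul_section_inv_mem j r)

theorem projScalar_one (h : H) : D.projScalar j 1 h = 1 := by
  unfold projScalar
  rw [D.φ_congr _ (m := 1), φ_one]
  have : j ((1 : Γ) : Γ ⧸ D.N) = 1 := j.map_one
  rw [this, inv_one, one_mul]

theorem projScalar_eval_one (r : Γ) : D.projScalar j r (1 : H) = 1 := D.φ_eval_one _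

theorem projScalar_section (x : Γ ⧸ D.N) (h : H) : D.projScalar j (j x) h = 1 := by
  unfold projScalar
  rw [D.φ_congr _ (m := 1), φ_one]
  rw [j.mk_toFun, mul_inv_cancel]

theorem projScalar_mul_left {n : Γ} (hn : n ∈ D.N) (r : Γ) (h : H) :
    D.projScalar j (n * r) h = D.φ h n hn * D.projScalar j r h := by
  unfold projScalar
  rw [φ_mul_φ]
  apply φ_congr
  have : ((n * r : Γ) : Γ ⧸ D.N) = r := by
    rw [QuotientGroup.mk_mul, (QuotientGroup.eq_one_iff n).2 hn, one_mul]
  rw [this, mul_assoc]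

/-- With `n_r = r j(r)⁻¹`, one has `n_{rs} = n_r · j(r) n_s j(r)⁻¹ · j(r) j(s) j(rs)⁻¹`, and `Φ`
ignores the conjugation. This is the multiplicativity of the projection. -/
theorem projScalar_mul (r s : Γ) (h : H) : D.projScalar j (r * s) h =
    D.projScalar j r h * D.projScalar j s h * (D.bismashData j).σ r s h := by
  change D.φ _ _ _ = D.φ _ _ _ * D.φ _ _ _ * D.φ _ _ _
  rw [D.φ_conj (D.mul_section_inv_mem j s) (j (r : Γ ⧸ D.N)), φ_mul_φ, φ_mul_φ]
  apply φ_congr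
  rw [QuotientGroup.mk_mul]
  group

/-- With `n_r = r j(r)⁻¹`, the cocycle identity turns `Φ(n_r)(h)` into `Φ(l.n_r)(lh) Φ(n_r)(l⁻¹)`,
and `l.n_r · l.j(r) j(l.r)⁻¹ = n_{l.r}`. This is the compatibility of the projection with
comultiplication. -/
theorem projScalar_smul (l : H) (r : Γ) (h : H) :
    D.projScalar j r h * (D.bismashData j).τ l r h =
      D.projScalar j r l⁻¹ * D.projScalar j (l • r) (l * h) := by
  change D.φ _ _ _ * D.φ _ _ _ = D.φ _ _ _ * D.φ _ _ _
  rw [D.φ_eq_smul l (D.mul_section_inv_mem j r), mul_right_comm, φ_mul_φ, mul_comm]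
  congr 1
  apply φ_congr
  rw [smul_mul', smul_inv', D.act_mk]
  group

variable [Fintype H] [DecidableEq H]

/-- The projection `r # δ_h ↦ u(r) # δ_h Φ(r j(u(r))⁻¹)`, as a linear map. -/
noncomputable def projLinear : SmashCoproduct k Γ H →ₗ[k] D.TwistedSmash j :=
  Bismash.lift fun r h => (D.projScalar j r h : k) • Bismash.b (r : Γ ⧸ D.N) h

theorem projLinear_b (r : Γ) (h : H) :
    D.projLinear j (Bismash.b r h) = (D.projScalar j r h : k) • Bismash.b (r : Γ ⧸ D.N) h :=
  Bismash.lift_b _ _ _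

theorem projLinear_one : D.projLinear j 1 = 1 := by
  rw [Bismash.one_eq_sum, Bismash.one_eq_sum, map_sum]
  refine Finset.sum_congr rfl fun h _ => ?_
  rw [projLinear_b, projScalar_one, Units.val_one, one_smul]
  rfl

theorem projLinear_mul (p q : SmashCoproduct k Γ H) :
    D.projLinear j (p * q) = D.projLinear j p * D.projLinear j q := by
  have key : (LinearMap.mul k (SmashCoproduct k Γ H)).compr₂ (D.projLinear j) =
      (LinearMap.mul k (D.TwistedSmash j)).compl₁₂ (D.projLinear j) (D.projLinear j) := by
    refine Bismash.hom_ext fun r h => Bismash.hom_ext fun s g => ?_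
    simp only [LinearMap.compr₂_apply, LinearMap.compl₁₂_apply, LinearMap.mul_apply']
    rw [projLinear_b, projLinear_b, smul_mul_smul_comm, SmashCoproduct.b_mul_b, Bismash.b_mul_b]
    split_ifs with hh
    · subst hh
      rw [projLinear_b, smul_smul, ← Units.val_mul, ← Units.val_mul, projScalar_mul,
        QuotientGroup.mk_mul]
    · rw [map_zero, smul_zero]
  exact congrArg (fun F => F p q) key

/-- The canonical projection `k[Γ] ⋊ k^H → k[Γ/N] ⋊_Φ k^H`. -/
noncomputable def proj : SmashCoproduct k Γ H →ₐc[k] D.TwistedSmash j :=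
  BialgHom.ofAlgHom
    (AlgHom.ofLinearMap (D.projLinear j) (D.projLinear_one j) (D.projLinear_mul j))
    (by
      apply AlgHom.toLinearMap_injective
      refine Bismash.hom_ext fun r h => ?_
      change Coalgebra.counit (R := k) (D.projLinear j (Bismash.b r h)) =
        Coalgebra.counit (R := k) (Bismash.b r h : SmashCoproduct k Γ H)
      rw [projLinear_b, map_smul, Bismash.counit_b, Bismash.counit_b]
      split_ifs with hh
      · rw [hh, projScalar_eval_one, Units.val_one, one_smul]
      · rw [smul_zero])
    (by
      apply AlgHom.toLinearMap_injective
      refine Bismash.hom_ext fun r h => ?_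
      change TensorProduct.map (D.projLinear j) (D.projLinear j)
        (Coalgebra.comul (R := k) (Bismash.b r h : SmashCoproduct k Γ H)) =
          Coalgebra.comul (R := k) (D.projLinear j (Bismash.b r h))
      rw [projLinear_b, map_smul, SmashCoproduct.comul_b, Bismash.comul_b, map_sum,
        Finset.smul_sum]
      refine Finset.sum_congr rfl fun l _ => ?_
      rw [TensorProduct.map_tmul, projLinear_b, projLinear_b, TensorProduct.smul_tmul_smul,
        smul_smul, ← Units.val_mul, ← Units.val_mul, projScalar_smul]
      rfl)

theorem proj_b (r : Γ) (h : H) :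
    D.proj j (Bismash.b r h) = (D.projScalar j r h : k) • Bismash.b (r : Γ ⧸ D.N) h :=
  D.projLinear_b j r h

theorem proj_b_mul_left {n : Γ} (hn : n ∈ D.N) (r : Γ) (h : H) :
    D.proj j (Bismash.b (n * r) h) = (D.φ h n hn : k) • D.proj j (Bismash.b r h) := by
  rw [proj_b, proj_b, projScalar_mul_left D j hn, smul_smul, Units.val_mul,
    QuotientGroup.mk_mul, (QuotientGroup.eq_one_iff n).2 hn, one_mul]

theorem proj_b_section (x : Γ ⧸ D.N) (h : H) :
    D.proj j (Bismash.b (j x) h) = Bismash.b x h := by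
  rw [proj_b, projScalar_section, Units.val_one, one_smul, j.mk_toFun]

theorem proj_surjective : Function.Surjective (D.proj j) := by
  intro p
  induction p using Bismash.induction with
  | zero => exact ⟨0, map_zero _⟩
  | add p q hp hq =>
    obtain ⟨p', rfl⟩ := hp
    obtain ⟨q', rfl⟩ := hq
    exact ⟨p' + q', map_add _ _ _⟩
  | smul c p hp =>
    obtain ⟨p', rfl⟩ := hp
    exact ⟨c • p', map_smul _ _ _⟩
  | base x h => exact ⟨_, D.proj_b_section j x h⟩

variable {D} {R : Type*} [Ring R] [Algebra k R] {ρ : SmashCoproduct k Γ H →ₐ[k] R}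

/-- Factor `nr # δ_h = (n # 1)(r # δ_h)`; `ρ` does not distinguish `n # 1` from `1 # Φ(n)`, which
multiplies `r # δ_h` by `Φ(n)(h)`. -/
theorem map_b_mul_left (hD : D ∈ compatibleData ρ) {n : Γ} (hn : n ∈ D.N) (r : Γ) (h : H) :
    ρ (Bismash.b (n * r) h) = (D.φ h n hn : k) • ρ (Bismash.b r h) := by
  have e := elt_mul_b n r (1 : FunHopf k H) h
  have e2 := elt_mul_b 1 r (D.Φ ⟨n, hn⟩ : FunHopf k H) h
  have e3 : (1 : FunHopf k H) h = 1 := rfl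
  rw [e3, one_smul] at e
  rw [one_mul] at e2
  rw [← e, map_mul, hD ⟨n, hn⟩, ← map_mul, e2, map_smul]
  rfl

/-- The linear map `x # δ_h ↦ ρ(j(x) # δ_h)`. -/
noncomputable def descendLinear (ρ : SmashCoproduct k Γ H →ₐ[k] R) (j : NormalizedSection D.N) :
    D.TwistedSmash j →ₗ[k] R :=
  Bismash.lift fun x h => ρ (Bismash.b (j x) h)

theorem descendLinear_proj (hD : D ∈ compatibleData ρ) (p : SmashCoproduct k Γ H) :
    descendLinear ρ j (D.proj j p) = ρ p := by
  have key : (descendLinear ρ j).comp (D.projLinear j) = ρ.toLinearMap := by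
    refine Bismash.hom_ext fun r h => ?_
    rw [LinearMap.comp_apply, projLinear_b, map_smul, descendLinear, Bismash.lift_b]
    have e := map_b_mul_left hD (D.mul_section_inv_mem j r) (j r) h
    rw [inv_mul_cancel_right] at e
    exact e.symm
  exact congrArg (fun F => F p) key

/-- The algebra map `k[Γ/N] ⋊_Φ k^H → R` induced by `ρ`. -/
noncomputable def descend (hD : D ∈ compatibleData ρ) (j : NormalizedSection D.N) :
    D.TwistedSmash j →ₐ[k] R :=
  AlgHom.ofLinearMap (descendLinear ρ j)
    (by rw [← map_one (D.proj j), descendLinear_proj j hD, map_one])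
    (fun p q => by
      obtain ⟨p, rfl⟩ := D.proj_surjective j p
      obtain ⟨q, rfl⟩ := D.proj_surjective j q
      rw [← map_mul, descendLinear_proj j hD, descendLinear_proj j hD, descendLinear_proj j hD,
        map_mul])

theorem isHopfFactorization_proj (hD : D ∈ compatibleData ρ) (j : NormalizedSection D.N) :
    IsHopfFactorization ρ (D.proj j) (descend hD j) :=
  ⟨D.proj_surjective j, AlgHom.ext fun p => descendLinear_proj j hD p⟩

end QuotientDatum

/-! ### Hopf algebra quotients `q` through which `ρ` factors. -/

namespace SmashCoproduct

variable {k Γ H L : Type*} [Field k] [Group Γ] [Group H] [MulDistribMulAction H Γ]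
  [Fintype H] [DecidableEq H] [Ring L] [HopfAlgebra k L] {q : SmashCoproduct k Γ H →ₐc[k] L}

theorem comul_map_b (q : SmashCoproduct k Γ H →ₐc[k] L) (r : Γ) (h : H) :
    Coalgebra.comul (R := k) (q (Bismash.b r h)) =
      ∑ l : H, q (Bismash.b r l⁻¹) ⊗ₜ[k] q (Bismash.b (l • r) (l * h)) := by
  rw [← CoalgHomClass.map_comp_comul_apply, comul_b, map_sum]
  rfl

theorem tmul_mul_comul_map_b (q : SmashCoproduct k Γ H →ₐc[k] L) (r : Γ) (g g' : H) :
    (q (Bismash.b 1 g) ⊗ₜ[k] q (Bismash.b 1 g')) *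
      Coalgebra.comul (R := k) (q (Bismash.b r (g * g'))) =
        q (Bismash.b r g) ⊗ₜ[k] q (Bismash.b (g⁻¹ • r) g') := by
  have e := congrArg (Algebra.TensorProduct.map (q : SmashCoproduct k Γ H →ₐ[k] L)
    (q : SmashCoproduct k Γ H →ₐ[k] L)) (tmul_mul_comul_b (k := k) r g g')
  rw [map_mul] at e
  rw [← CoalgHomClass.map_comp_comul_apply]
  exact e

theorem map_b_mul_map_b (q : SmashCoproduct k Γ H →ₐc[k] L) (r s : Γ) (h : H) :
    q (Bismash.b r h) * q (Bismash.b s h) = q (Bismash.b (r * s) h) := by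
  rw [← map_mul, b_mul_b_self]

/-- Multiplying by `q(r⁻¹ # δ_h)` returns `q(1 # δ_h)`. -/
theorem map_b_ne_zero (hq : ∀ h, q (Bismash.b 1 h) ≠ 0) (r : Γ) (h : H) :
    q (Bismash.b r h) ≠ 0 := by
  intro e
  apply hq h
  rw [← mul_inv_cancel r, ← map_b_mul_map_b, e, zero_mul]

/-- Cut the comultiplied relation down by `q(1 # δ_g) ⊗ q(1 # δ_g')`: one proportionality at `gg'`
constrains the values at `g` and at `g'`. -/
theorem tmul_map_b_eq (q : SmashCoproduct k Γ H →ₐc[k] L) {r : Γ} {g g' : H} {c : k}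
    (h : q (Bismash.b r (g * g')) = c • q (Bismash.b 1 (g * g'))) :
    q (Bismash.b r g) ⊗ₜ[k] q (Bismash.b (g⁻¹ • r) g') =
      c • (q (Bismash.b 1 g) ⊗ₜ[k] q (Bismash.b 1 g')) := by
  rw [← tmul_mul_comul_map_b, h, map_smul, mul_smul_comm, tmul_mul_comul_map_b, smul_one]

theorem exists_map_b_eq_smul (hq : ∀ h, q (Bismash.b 1 h) ≠ 0) {r : Γ}
    (hr : q (Bismash.b r 1) = q (Bismash.b 1 1)) (h : H) :
    ∃ c : k, q (Bismash.b r h) = c • q (Bismash.b 1 h) := by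
  have e := tmul_map_b_eq q (r := r) (g := h) (g' := h⁻¹) (c := 1) (by
    rw [mul_inv_cancel, hr, one_smul])
  rw [one_smul] at e
  exact exists_smul_of_tmul_eq (map_b_ne_zero hq _ _) e

/-- Splitting `1 = l⁻¹ l` makes `q(l.r # δ_l)` proportional to `q(1 # δ_l)`; splitting `l = 1 · l`
then makes `q(l.r # δ_1)` proportional to `q(1 # δ_1)`, and the counit shows that the factor is 1.
-/
theorem map_smul_b_one (hq : ∀ h, q (Bismash.b 1 h) ≠ 0) {r : Γ}
    (hr : q (Bismash.b r 1) = q (Bismash.b 1 1)) (l : H) :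
    q (Bismash.b (l • r) 1) = q (Bismash.b 1 1) := by
  have e := tmul_map_b_eq q (r := r) (g := l⁻¹) (g' := l) (c := 1) (by
    rw [inv_mul_cancel, hr, one_smul])
  rw [one_smul, inv_inv] at e
  obtain ⟨c, hc⟩ := exists_smul_of_tmul_eq (map_b_ne_zero hq r l⁻¹)
    (congrArg (TensorProduct.comm k L L) e)
  dsimp only at hc
  have e2 := tmul_map_b_eq q (r := l • r) (g := 1) (g' := l) (c := c) (by rw [one_mul, hc])
  rw [TensorProduct.smul_tmul', inv_one, one_smul] at e2
  obtain ⟨d, hd⟩ := exists_smul_of_tmul_eq (map_b_ne_zero hq (l • r) l) e2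
  rw [smul_smul] at hd
  have e3 := congrArg (Coalgebra.counit (R := k)) hd
  rw [map_smul, CoalgHomClass.counit_comp_apply, CoalgHomClass.counit_comp_apply, counit_b,
    counit_b, if_pos rfl, smul_eq_mul, mul_one] at e3
  rw [hd, ← e3, one_smul]

/-- The idempotent `e = q(1 # δ_1)` satisfies `(e ⊗ e) Δ(v) = v ⊗ v` for `v = q(r # δ_1)`, so these
vectors behave as group-like elements. -/
theorem linearIndepOn_range_map_b_one (hq : ∀ h, q (Bismash.b 1 h) ≠ 0) :
    LinearIndepOn k id (Set.range fun r : Γ => q (Bismash.b r 1)) := by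
  refine linearIndepOn_of_map_eq_tmul_self
    ((LinearMap.mulLeft k (q (Bismash.b 1 1) ⊗ₜ[k] q (Bismash.b 1 1))).comp Coalgebra.comul) ?_ ?_
  · rintro _ ⟨r, rfl⟩
    exact map_b_ne_zero hq r 1
  · rintro _ ⟨r, rfl⟩
    have e := tmul_mul_comul_map_b q r 1 1
    rw [mul_one, inv_one, one_smul] at e
    exact e

variable {R : Type*} [Ring R] [Algebra k R] {ρ : SmashCoproduct k Γ H →ₐ[k] R} {φ : L →ₐ[k] R}

theorem map_b_one_left_ne_zero (hρ : InnerFaithful (ρ.comp (incl k Γ H)))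
    (hφ : IsHopfFactorization ρ q φ) (h : H) : q (Bismash.b 1 h) ≠ 0 := by
  refine FunHopf.mem_of_innerFaithful hρ
    { carrier := {h | q (Bismash.b 1 h) ≠ 0}
      mul_mem' := fun {g h} hg hh e => ?_
      one_mem' := fun e => ?_ } (fun h hh => ?_) h
  · have e2 := tmul_mul_comul_map_b q 1 g h
    rw [e, map_zero, mul_zero, smul_one] at e2
    exact tmul_ne_zero_of_field hg hh e2.symm
  · have e2 := congrArg (Coalgebra.counit (R := k)) e
    rw [CoalgHomClass.counit_comp_apply, counit_b, if_pos rfl, map_zero] at e2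
    exact one_ne_zero e2
  · have e : q (Bismash.b 1 h) = 0 := not_not.1 hh
    rw [AlgHom.comp_apply, incl_δ, ← hφ.comp_eq]
    change φ (q _) = 0
    rw [e, map_zero]

theorem mem_imageSubgroup (hq : ∀ h, q (Bismash.b 1 h) ≠ 0) (hφ : IsHopfFactorization ρ q φ)
    {r : Γ} (hr : q (Bismash.b r 1) = q (Bismash.b 1 1)) : r ∈ imageSubgroup ρ := by
  intro h
  choose c hc using exists_map_b_eq_smul hq (map_smul_b_one hq hr h)
  -- The proportionality factors, as a function on `H`, are the invertible `f` required by
  -- `imageSubgroup`.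
  have hc0 (g : H) : c g ≠ 0 := fun e =>
    map_b_ne_zero hq (h • r) g (by rw [hc, e, zero_smul])
  refine ⟨⟨c, fun g => (c g)⁻¹, funext fun g => mul_inv_cancel₀ (hc0 g),
    funext fun g => inv_mul_cancel₀ (hc0 g)⟩, ?_⟩
  rw [← hφ.comp_eq]
  change φ (q _) = φ (q _)
  congr 1
  unfold elt
  rw [map_sum, map_sum]
  refine Finset.sum_congr rfl fun g _ => ?_
  rw [map_smul, map_smul, hc]
  exact one_smul k _

/-- The `h` at which the formula holds for all such `r` form a submonoid, by the cocycle identity of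
`Φ`. Where `ρ(1 # δ_h) ≠ 0`, applying `φ` reads off the unknown factor, so inner faithfulness
applies. -/
theorem map_b_eq_φ_smul (hρ : InnerFaithful (ρ.comp (incl k Γ H)))
    (hφ : IsHopfFactorization ρ q φ) {D : QuotientDatum k Γ H} (hD : D ∈ compatibleData ρ)
    (hN : D.N = imageSubgroup ρ) {r : Γ} (hr : q (Bismash.b r 1) = q (Bismash.b 1 1)) (h : H) :
    q (Bismash.b r h) =
      (D.φ h r (hN ▸ mem_imageSubgroup (map_b_one_left_ne_zero hρ hφ) hφ hr) : k) •
        q (Bismash.b 1 h) := by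
  have hq := map_b_one_left_ne_zero hρ hφ
  have hM {r : Γ} (hr : q (Bismash.b r 1) = q (Bismash.b 1 1)) : r ∈ D.N :=
    hN ▸ mem_imageSubgroup hq hφ hr
  refine FunHopf.mem_of_innerFaithful hρ
    { carrier := {h | ∀ (r : Γ) (hr : q (Bismash.b r 1) = q (Bismash.b 1 1)),
        q (Bismash.b r h) = (D.φ h r (hM hr) : k) • q (Bismash.b 1 h)}
      mul_mem' := fun {l h} hl hh r hr => ?_
      one_mem' := fun r hr => ?_ } (fun h hh => ?_) h r hr
  · obtain ⟨c, hc⟩ := exists_map_b_eq_smul hq hr (l * h)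
    have e := tmul_map_b_eq q hc
    rw [hl r hr, hh _ (map_smul_b_one hq hr l⁻¹), TensorProduct.smul_tmul_smul,
      ← Units.val_mul, mul_comm, ← D.φ_smul (hM hr)] at e
    rw [hc, smul_left_injective k (tmul_ne_zero_of_field (hq l) (hq h)) e]
  · rw [D.φ_eval_one, Units.val_one, one_smul, hr]
  · rw [AlgHom.comp_apply, incl_δ]
    by_contra h0
    refine hh fun r hr => ?_
    obtain ⟨c, hc⟩ := exists_map_b_eq_smul hq hr h
    have e1 := QuotientDatum.map_b_mul_left hD (hM hr) 1 h
    have e2 : ρ (Bismash.b r h) = c • ρ (Bismash.b 1 h) := by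
      rw [← hφ.comp_eq]
      change φ (q _) = c • φ (q _)
      rw [hc, map_smul]
    rw [mul_one, e2] at e1
    rw [hc, smul_left_injective k h0 e1]

theorem exists_linearMap_comp_eq_proj (hρ : InnerFaithful (ρ.comp (incl k Γ H)))
    (hφ : IsHopfFactorization ρ q φ) {D : QuotientDatum k Γ H} (hD : D ∈ compatibleData ρ)
    (hN : D.N = imageSubgroup ρ) (j : NormalizedSection D.N) :
    ∃ F : L →ₗ[k] D.TwistedSmash j, ∀ p, F (q p) = D.proj j p := by
  have hq := map_b_one_left_ne_zero hρ hφ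
  -- `ω r h` reads off the coefficient of a vector proportional to `q(r # δ_h)`.
  choose ω hω using fun (r : Γ) (h : H) => exists_dual_apply_eq_one (k := k) (map_b_ne_zero hq r h)
  -- A chosen `s` with `q(s # δ_1) = v`; its value off the range is irrelevant, as `T` is only
  -- prescribed on the range.
  let rep : L → Γ := Function.invFun fun r => q (Bismash.b r 1)
  -- For `s = rep v`, the map `T v` isolates the `δ_g` component, measures it against `q(g.s # δ_g)`
  -- and outputs that multiple of `proj (g.s # δ_g)`.
  obtain ⟨T, hT⟩ := (linearIndepOn_range_map_b_one hq).exists_linearMap fun v =>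
    (∑ g : H, ((ω (g • rep v) g).comp (LinearMap.mulLeft k (q (Bismash.b 1 g)))).smulRight
      (D.proj j (Bismash.b (g • rep v) g)) : L →ₗ[k] D.TwistedSmash j)
  have hT' (r : Γ) (h : H) : T (q (Bismash.b (h⁻¹ • r) 1)) (q (Bismash.b r h)) =
      D.proj j (Bismash.b r h) := by
    set s := rep (q (Bismash.b (h⁻¹ • r) 1)) with hs
    have hs' : q (Bismash.b s 1) = q (Bismash.b (h⁻¹ • r) 1) :=
      Function.invFun_eq (f := fun r => q (Bismash.b r 1)) ⟨h⁻¹ • r, rfl⟩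
    -- Since `s` and `h⁻¹.r` have the same image, `r` and `h.s` differ by an element to which
    -- `map_b_eq_φ_smul` applies; `q` and `proj` therefore turn it into the same scalar.
    have hn : q (Bismash.b (r * (h • s)⁻¹) 1) = q (Bismash.b 1 1) := by
      have e : q (Bismash.b ((h⁻¹ • r) * s⁻¹) 1) = q (Bismash.b 1 1) := by
        rw [← map_b_mul_map_b, ← hs', map_b_mul_map_b, mul_inv_cancel]
      have e2 := map_smul_b_one hq e h
      rwa [smul_mul', smul_inv_smul, smul_inv'] at e2
    have hrs : r = r * (h • s)⁻¹ * h • s := (inv_mul_cancel_right _ _).symm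
    have hmem : r * (h • s)⁻¹ ∈ D.N := hN ▸ mem_imageSubgroup hq hφ hn
    rw [hT _ ⟨_, rfl⟩, LinearMap.sum_apply, Finset.sum_eq_single h]
    · rw [← hs, LinearMap.smulRight_apply, LinearMap.comp_apply, LinearMap.mulLeft_apply,
        map_b_mul_map_b, one_mul]
      conv_rhs => rw [hrs, D.proj_b_mul_left j hmem]
      congr 1
      have e3 := map_b_mul_map_b q (r * (h • s)⁻¹) (h • s) h
      rw [← hrs, map_b_eq_φ_smul hρ hφ hD hN hn, smul_mul_assoc, map_b_mul_map_b, one_mul] at e3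
      rw [← e3, map_smul, hω, smul_eq_mul, mul_one]
    · intro g _ hg
      rw [LinearMap.smulRight_apply, LinearMap.comp_apply, LinearMap.mulLeft_apply, ← map_mul,
        b_mul_b, if_neg hg, map_zero, map_zero, zero_smul]
    · simp
  -- `F x = ∑ T(q(1 # δ_1) x₂)(x₁)`. For `x = q(r # δ_h)` only the term `l = h⁻¹` of `Δ` survives,
  -- with `x₁ = x` and second leg `q(h⁻¹.r # δ_1)`.
  let F : L →ₗ[k] D.TwistedSmash j :=
    (TensorProduct.lift (T.comp (LinearMap.mulLeft k (q (Bismash.b 1 1)))).flip).comp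
      Coalgebra.comul
  have hF : F.comp (q : SmashCoproduct k Γ H →ₐ[k] L).toLinearMap =
      (D.proj j : SmashCoproduct k Γ H →ₐ[k] D.TwistedSmash j).toLinearMap := by
    refine Bismash.hom_ext fun r h => ?_
    change TensorProduct.lift _ (Coalgebra.comul (R := k) (q (Bismash.b r h))) =
      D.proj j (Bismash.b r h)
    rw [comul_map_b, map_sum, Finset.sum_eq_single h⁻¹]
    · rw [TensorProduct.lift.tmul, LinearMap.flip_apply, LinearMap.comp_apply,
        LinearMap.mulLeft_apply, inv_mul_cancel, map_b_mul_map_b, one_mul, inv_inv, hT']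
    · intro l _ hl
      rw [TensorProduct.lift.tmul, LinearMap.flip_apply, LinearMap.comp_apply,
        LinearMap.mulLeft_apply, ← map_mul, b_mul_b, if_neg, map_zero, map_zero,
        LinearMap.zero_apply]
      exact fun e => hl (eq_inv_of_mul_eq_one_left e.symm)
    · simp
  exact ⟨F, fun p => congrArg (fun G => G p) hF⟩

end SmashCoproduct

/-! ### From the linear map to the Hopf image. -/

/-- A linear map `F` with `F q = p`, for bialgebra maps `q` and `p` with `q` surjective, is a
bialgebra map. -/
theorem exists_bialgHom_comp_eq {k A B C : Type*} [Field k] [Ring A] [Bialgebra k A] [Ring B]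
    [Bialgebra k B] [Ring C] [Bialgebra k C] {q : A →ₐc[k] B} (hq : Function.Surjective q)
    (p : A →ₐc[k] C) (F : B →ₗ[k] C) (hF : ∀ a, F (q a) = p a) :
    ∃ f : B →ₐc[k] C, f.comp q = p := by
  refine ⟨BialgHom.ofAlgHom (AlgHom.ofLinearMap F ?_ ?_) ?_ ?_, ?_⟩
  · rw [← map_one q, hF, map_one]
  · intro x y
    obtain ⟨x, rfl⟩ := hq x
    obtain ⟨y, rfl⟩ := hq y
    rw [← map_mul, hF, hF, hF, map_mul]
  · ext x
    obtain ⟨x, rfl⟩ := hq x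
    change Coalgebra.counit (R := k) (F (q x)) = Coalgebra.counit (R := k) (q x)
    rw [hF, CoalgHomClass.counit_comp_apply, CoalgHomClass.counit_comp_apply]
  · ext x
    obtain ⟨x, rfl⟩ := hq x
    change TensorProduct.map F F (Coalgebra.comul (R := k) (q x)) =
      Coalgebra.comul (R := k) (F (q x))
    rw [hF, ← CoalgHomClass.map_comp_comul_apply p, ← CoalgHomClass.map_comp_comul_apply q,
      ← LinearMap.comp_apply, ← TensorProduct.map_comp]
    congr 2 <;> exact LinearMap.ext hF
  · ext x
    exact hF x

/-- `s # 1` commutes with `1 # f`, so the `f` that serves `h.r` also serves `h.(s r s⁻¹)`. -/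
theorem imageSubgroup_normal {k Γ H R : Type*} [Field k] [Group Γ] [Group H]
    [MulDistribMulAction H Γ] [Fintype H] [DecidableEq H] [Ring R] [Algebra k R]
    (ρ : SmashCoproduct k Γ H →ₐ[k] R) : (imageSubgroup ρ).Normal where
  conj_mem r hr s h := by
    obtain ⟨f, hf⟩ := hr h
    refine ⟨f, ?_⟩
    have e (x y : Γ) (f g : FunHopf k H) :=
      congrArg ρ (SmashCoproduct.elt_mul_elt (k := k) x y f g)
    simp only [map_mul] at e
    have e1 := e (h • s * h • r) (h • s)⁻¹ 1 1
    have e2 := e (h • s) (h • r) 1 1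
    have e3 := e (h • s) 1 1 (f : FunHopf k H)
    have e4 := e (h • s) (h • s)⁻¹ (f : FunHopf k H) 1
    simp only [one_mul, mul_one, mul_inv_cancel] at e1 e2 e3 e4
    rw [smul_mul', smul_mul', smul_inv', ← e1, ← e2, hf, e3, e4]

theorem corollary4p3 {k Γ H R : Type*}
    [Field k] [Group Γ] [Group H] [Fintype H] [DecidableEq H] [MulDistribMulAction H Γ]
    [Ring R] [Algebra k R] (ρ : SmashCoproduct k Γ H →ₐ[k] R)
    (hρ : InnerFaithful (ρ.comp (SmashCoproduct.incl k Γ H))) :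
    (imageSubgroup ρ).Normal ∧
    (∀ (h : H), ∀ r ∈ imageSubgroup ρ, h • r ∈ imageSubgroup ρ) ∧
    ∀ D ∈ compatibleData ρ, D.N = imageSubgroup ρ → ∀ j : NormalizedSection D.N,
      ∃ (p : SmashCoproduct k Γ H →ₐc[k] D.TwistedSmash j) (ρ' : D.TwistedSmash j →ₐ[k] R),
        IsHopfImage.{w} ρ p ρ' := by
  refine ⟨imageSubgroup_normal ρ, fun h r hr g => ?_, fun D hD hN j => ?_⟩
  · rw [← mul_smul]
    exact hr (g * h)
  · refine ⟨D.proj j, QuotientDatum.descend hD j, QuotientDatum.isHopfFactorization_proj hD j,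
      fun L _ _ q φ hφ => ?_⟩
    obtain ⟨F, hF⟩ := SmashCoproduct.exists_linearMap_comp_eq_proj hρ hφ hD hN j
    obtain ⟨f, hf⟩ := exists_bialgHom_comp_eq hφ.surjective (D.proj j) F hF
    have hf' (x) : f (q x) = D.proj j x := congrArg (fun G => G x) hf
    -- Both the compatibility with `φ` and uniqueness are checked on elements `q x`, which exhaust
    -- `L`.
    refine ⟨f, ⟨hf, ?_⟩, fun g hg => ?_⟩
    · ext y
      obtain ⟨x, rfl⟩ := hφ.surjective y
      change QuotientDatum.descendLinear ρ j (f (q x)) = φ (q x)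
      rw [hf', QuotientDatum.descendLinear_proj j hD, ← hφ.comp_eq]
      rfl
    · ext y
      obtain ⟨x, rfl⟩ := hφ.surjective y
      rw [hf', ← hg.1]
      rfl
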